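/- Work over $\mathbb{C}$. Let $G$ be a smooth quadric in $\mathbb{P}^5$, given by an invertible symmetric $6\times 6$ matrix, also denoted by $G$, and let $SO(G)=\{A \mid \det A=1,\ A^tGA=G\}$. A quadratic line complex $X=F\cap G$ (with $F\neq G$ a quadric) is identified with its pencil $\{\lambda F+\mu G\}$, i.e. with a line through $G$ in the projective space $\mathbb{P}^{20}$ of quadrics in $\mathbb{P}^5$; the group $SO(G)$ acts on the set of these complexes by $(A,X)\mapsto A(X)$. For a root $p\in\mathbb{P}^1$ of the discriminant $\det(\lambda F+\mu G)$ let $l_i$ be the minimum multiplicity of $p$ as a root of the subdeterminants of order $6-i$ of $\lambda F+\mu G$, and let $d$ be the largest index with $l_d>0$. The bracket of $p$ is $(e_0\dots e_d)$ with $e_i=l_i-l_{i+1}$; its length is $d+1$. The Segre symbol of $X$ is the collection of the brackets of all distinct roots. Let $\sigma$ be a Segre symbol that contains no bracket of length $\geq 4$ and consists of at least $3$ brackets, and let $r_i$ be the number of brackets of length $i$ in $\sigma$, for $i=1,2,3$. Then for every quadratic complex $X$ with Segre symbol $\sigma$ the stabilizer of $X$ in $SO(G)$ has dimension $$\dim \mathrm{Stab}(X)=r_2+3r_3,$$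 except in the case $\sigma=[(22)11]$, where it has dimension $2$. In particular the dimension of the stabilizer depends only on $\sigma$ and not on the complex $X$ with Segre symbol $\sigma$. -/

import Mathlib

noncomputable section

namespace QuadraticLineComplex

open Matrix Polynomial

/-! A quadric in `ℙⁿ⁻¹` over `ℂ` is given, up to a nonzero constant, by a symmetric `n × n` matrix. -/

/-! ### Segre symbols of pencils of quadrics -/

/-- The matrix `F + t G` over `ℂ[t]`: the pencil `λ F + μ G` in the affine coordinate `t = μ / λ`.
When `G` is smooth the point `(λ : μ) = (0 : 1)` is not a root of the discriminant, so all the roots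
lie in this affine chart. -/
def pencilMatrix {n : ℕ} (F G : Matrix (Fin n) (Fin n) ℂ) : Matrix (Fin n) (Fin n) ℂ[X] :=
  F.map C + (X : ℂ[X]) • G.map C

/-- The discriminant `det (F + t G)` of the pencil. -/
def discriminant {n : ℕ} (F G : Matrix (Fin n) (Fin n) ℂ) : ℂ[X] :=
  (pencilMatrix F G).det

/-- `minorMult F G a i` is the number `l_i` of the root `a`: the minimum multiplicity of `t = a` as
a root of the subdeterminants of order `n - i` of `F + t G` (the zero polynomial has infinite
multiplicity; the minimum is finite for `i ≤ n` when `det G ≠ 0`). -/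
def minorMult {n : ℕ} (F G : Matrix (Fin n) (Fin n) ℂ) (a : ℂ) (i : ℕ) : ℕ :=
  (⨅ (f : Fin (n - i) ↪o Fin n) (g : Fin (n - i) ↪o Fin n),
    emultiplicity (X - C a) ((pencilMatrix F G).submatrix f g).det).toNat

/-- The bracket `(e_0, …, e_d)` of the root `a`: here `e_i = l_i - l_{i+1}`, and `i = 0, …, d` are
the indices for which all subdeterminants of order `n - i` vanish at `a`, i.e. `l_i > 0`. -/
def bracket {n : ℕ} (F G : Matrix (Fin n) (Fin n) ℂ) (a : ℂ) : List ℕ :=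
  ((List.range n).filter fun i => 0 < minorMult F G a i).map
    fun i => minorMult F G a i - minorMult F G a (i + 1)

/-- The Segre symbol of the pencil spanned by `F` and the smooth quadric `G`: the unordered
collection of the brackets of the distinct roots of the discriminant. -/
def segreSymbol {n : ℕ} (F G : Matrix (Fin n) (Fin n) ℂ) : Multiset (List ℕ) :=
  (discriminant F G).roots.dedup.map (bracket F G)

/-! ### The special orthogonal group of a quadric and its action on quadratic complexes -/

/-- The group `SO(G)` of the matrices `A` with `det A = 1` and `Aᵗ G A = G`. -/
def SO (G : Matrix (Fin 6) (Fin 6) ℂ) : Subgroup (GL (Fin 6) ℂ) where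
  carrier := {A | A.val.det = 1 ∧ A.valᵀ * G * A.val = G}
  one_mem' := by simp
  mul_mem' := by
    rintro A B ⟨hA, hA'⟩ ⟨hB, hB'⟩
    refine ⟨by rw [Units.val_mul, det_mul, hA, hB, one_mul], ?_⟩
    calc _ = B.valᵀ * (A.valᵀ * G * A.val) * B.val := by
          simp only [Units.val_mul, transpose_mul, Matrix.mul_assoc]
      _ = G := by rw [hA', hB']
  inv_mem' := by
    rintro A ⟨hA, hA'⟩
    have h1 : A.val * (A⁻¹).val = 1 := A.mul_inv
    have h2 : (A⁻¹).valᵀ * A.valᵀ = 1 := by rw [← transpose_mul, h1, transpose_one]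
    refine ⟨?_, ?_⟩
    · have h3 := congrArg det h1
      rwa [det_mul, hA, one_mul, det_one] at h3
    · calc (A⁻¹).valᵀ * G * (A⁻¹).val = (A⁻¹).valᵀ * (A.valᵀ * G * A.val) * (A⁻¹).val := by
            rw [hA']
        _ = ((A⁻¹).valᵀ * A.valᵀ) * G * (A.val * (A⁻¹).val) := by
            simp only [Matrix.mul_assoc]
        _ = G := by rw [h1, h2, Matrix.one_mul, Matrix.mul_one]

/-- A quadratic line complex `X = F ∩ G`, given by its associated pencil: a line through `G` in the
projective space of quadrics in `ℙ⁵`, i.e. a two-dimensional space of symmetric matrices that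
contains `G`. -/
@[ext]
structure QuadraticComplex (G : Matrix (Fin 6) (Fin 6) ℂ) where
  pencil : Submodule ℂ (Matrix (Fin 6) (Fin 6) ℂ)
  isSymm_of_mem : ∀ Q ∈ pencil, Q.IsSymm
  finrank_pencil : Module.finrank ℂ pencil = 2
  mem_pencil : G ∈ pencil

/-- `X` has Segre symbol `σ`: its pencil is spanned by `G` and a quadric `F` such that `λ F + μ G`
has Segre symbol `σ`. (The Segre symbol does not depend on the choice of `F`.) -/
def QuadraticComplex.HasSegreSymbol {G : Matrix (Fin 6) (Fin 6) ℂ} (X : QuadraticComplex G)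
    (σ : Multiset (List ℕ)) : Prop :=
  ∃ F : Matrix (Fin 6) (Fin 6) ℂ, X.pencil = Submodule.span ℂ {F, G} ∧ segreSymbol F G = σ

/-- The linear automorphism `Q ↦ (A⁻¹)ᵗ Q A⁻¹` of the space of matrices; it takes (the equation of)
a quadric `Q` to (the equation of) its image under `x ↦ A x`. -/
def transport (A : GL (Fin 6) ℂ) :
    Matrix (Fin 6) (Fin 6) ℂ ≃ₗ[ℂ] Matrix (Fin 6) (Fin 6) ℂ where
  toFun Q := (A⁻¹).valᵀ * Q * (A⁻¹).val
  invFun Q := A.valᵀ * Q * A.val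
  map_add' P Q := by rw [Matrix.mul_add, Matrix.add_mul]
  map_smul' c Q := by rw [Matrix.mul_smul, Matrix.smul_mul, RingHom.id_apply]
  left_inv Q := by
    have h1 : (A⁻¹).val * A.val = 1 := A.inv_mul
    have h2 : A.valᵀ * (A⁻¹).valᵀ = 1 := by rw [← transpose_mul, h1, transpose_one]
    calc _ = (A.valᵀ * (A⁻¹).valᵀ) * Q * ((A⁻¹).val * A.val) := by
            simp only [Matrix.mul_assoc]
      _ = Q := by rw [h1, h2, Matrix.one_mul, Matrix.mul_one]
  right_inv Q := by
    have h1 : A.val * (A⁻¹).val = 1 := A.mul_inv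
    have h2 : (A⁻¹).valᵀ * A.valᵀ = 1 := by rw [← transpose_mul, h1, transpose_one]
    calc _ = ((A⁻¹).valᵀ * A.valᵀ) * Q * (A.val * (A⁻¹).val) := by
            simp only [Matrix.mul_assoc]
      _ = Q := by rw [h1, h2, Matrix.one_mul, Matrix.mul_one]

theorem transport_apply (A : GL (Fin 6) ℂ) (Q : Matrix (Fin 6) (Fin 6) ℂ) :
    transport A Q = (A⁻¹).valᵀ * Q * (A⁻¹).val := rfl

theorem transport_one (Q : Matrix (Fin 6) (Fin 6) ℂ) : transport 1 Q = Q := by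
  rw [transport_apply, inv_one, Units.val_one, transpose_one, Matrix.one_mul, Matrix.mul_one]

theorem transport_mul (A B : GL (Fin 6) ℂ) (Q : Matrix (Fin 6) (Fin 6) ℂ) :
    transport (A * B) Q = transport A (transport B Q) := by
  simp only [transport_apply, _root_.mul_inv_rev, Units.val_mul, transpose_mul, Matrix.mul_assoc]

/-- The image `A(X)` of the quadratic complex `X` under `A ∈ SO(G)`. -/
def QuadraticComplex.image {G : Matrix (Fin 6) (Fin 6) ℂ} (A : SO G) (X : QuadraticComplex G) :
    QuadraticComplex G where
  pencil := X.pencil.map (transport A.val).toLinearMap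
  isSymm_of_mem := by
    rintro _ ⟨Q, hQ, rfl⟩
    have h : Qᵀ = Q := X.isSymm_of_mem Q hQ
    change (transport A.val Q)ᵀ = transport A.val Q
    rw [transport_apply]
    simp only [transpose_mul, transpose_transpose, h, Matrix.mul_assoc]
  finrank_pencil := by
    rw [LinearEquiv.finrank_map_eq, X.finrank_pencil]
  mem_pencil := ⟨G, X.mem_pencil, (A⁻¹).2.2⟩

/-- `SO(G)` acts on quadratic complexes by `(A, X) ↦ A(X)`. -/
instance (G : Matrix (Fin 6) (Fin 6) ℂ) : MulAction (SO G) (QuadraticComplex G) where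
  smul A X := X.image A
  one_smul X := by
    apply QuadraticComplex.ext
    ext Q
    constructor
    · rintro ⟨P, hP, rfl⟩
      have h : transport 1 P = P := transport_one P
      exact h.symm ▸ hP
    · intro hQ
      exact ⟨Q, hQ, transport_one Q⟩
  mul_smul A B X := by
    apply QuadraticComplex.ext
    ext Q
    constructor
    · rintro ⟨P, hP, rfl⟩
      exact ⟨transport B.val P, ⟨P, hP, rfl⟩, (transport_mul A.val B.val P).symm⟩
    · rintro ⟨_, ⟨P, hP, rfl⟩, rfl⟩
      exact ⟨P, hP, transport_mul A.val B.val P⟩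

/-- The stabilizer of the quadratic complex `X` in `SO(G)`. -/
def QuadraticComplex.stab {G : Matrix (Fin 6) (Fin 6) ℂ} (X : QuadraticComplex G) :
    Subgroup (SO G) :=
  MulAction.stabilizer (SO G) X

/-! ### Dimension -/

/-- The set of matrices that underlies a subgroup of `SO(G)`. -/
def matrixSet {G : Matrix (Fin 6) (Fin 6) ℂ} (H : Subgroup (SO G)) :
    Set (Matrix (Fin 6) (Fin 6) ℂ) :=
  {M | ∃ A ∈ H, A.val.val = M}

/-- The ideal of all polynomials in the matrix entries that vanish on a set of matrices. -/
def vanishingIdeal (S : Set (Matrix (Fin 6) (Fin 6) ℂ)) :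
    Ideal (MvPolynomial (Fin 6 × Fin 6) ℂ) :=
  MvPolynomial.vanishingIdeal ℂ ((fun (M : Matrix (Fin 6) (Fin 6) ℂ) p => M p.1 p.2) '' S)

/-- The dimension of a subgroup `H` of `SO(G)` that is closed in the Zariski topology, as an
algebraic variety: the Krull dimension of its ring of regular functions. (`SO(G)`, and hence `H`,
is Zariski closed in the affine space of all matrices.) -/
def dim {G : Matrix (Fin 6) (Fin 6) ℂ} (H : Subgroup (SO G)) : WithBot ℕ∞ :=
  ringKrullDim (MvPolynomial (Fin 6 × Fin 6) ℂ ⧸ vanishingIdeal (matrixSet H))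

/-- The number of brackets of length `i` in a Segre symbol. -/
def numBrackets (σ : Multiset (List ℕ)) (i : ℕ) : ℕ :=
  σ.countP fun b => b.length = i

end QuadraticLineComplex

end

noncomputable section

namespace QuadraticLineComplex

open Matrix Polynomial
open scoped Pointwise

section KrullDimension

theorem ringKrullDim_eq_of_isIntegral {R S : Type*} [CommRing R] [CommRing S] [Algebra R S]
    [Algebra.IsIntegral R S] (hinj : Function.Injective (algebraMap R S)) :
    ringKrullDim S = ringKrullDim R := by
  apply le_antisymm
  · refine Order.krullDim_le_of_strictMono (PrimeSpectrum.comap (algebraMap R S)) ?_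
    intro p q hpq
    exact Ideal.IsIntegral.comap_lt_comap (R := R) hpq
  · refine iSup_le fun l => ?_
    have := (faithfulSMul_iff_algebraMap_injective R S).mpr hinj
    obtain ⟨P, hP⟩ := Algebra.IsIntegral.comap_surjective (R := R) (S := S) l.head
    have : P.asIdeal.LiesOver l.head.asIdeal := ⟨by rw [← hP]; rfl⟩
    obtain ⟨L, hL, -⟩ := Ideal.exists_ltSeries_of_hasGoingUp l P.asIdeal
    rw [← hL]
    exact Order.LTSeries.length_le_krullDim L

theorem ringKrullDim_eq_of_trdeg_eq.{u} {k A : Type u} [Field k] [CommRing A] [IsDomain A]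
    [Algebra k A] [Algebra.FiniteType k A] {r : ℕ} (h : Algebra.trdeg k A = r) :
    ringKrullDim A = r := by
  obtain ⟨s, g, hinj, hint⟩ := exists_integral_inj_algHom_of_fg k A
  algebraize [g.toRingHom]
  have : IsScalarTower k (MvPolynomial (Fin s) k) A := .of_algHom g
  have hA : Algebra.IsIntegral (MvPolynomial (Fin s) k) A := ⟨hint⟩
  have : FaithfulSMul (MvPolynomial (Fin s) k) A :=
    (faithfulSMul_iff_algebraMap_injective _ _).mpr hinj
  have h1 := _root_.trdeg_add_eq k (MvPolynomial (Fin s) k) (A := A)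
  rw [_root_.trdeg_eq_zero (R := MvPolynomial (Fin s) k), add_zero,
    MvPolynomial.trdeg_of_isDomain, h] at h1
  have hs : s = r := by simpa using h1
  rw [ringKrullDim_eq_of_isIntegral (R := MvPolynomial (Fin s) k) hinj,
    MvPolynomial.ringKrullDim_of_isNoetherianRing, ringKrullDim_eq_zero_of_field, hs]
  simp

theorem ringKrullDim_quotient_iInf_le {R : Type*} [CommRing R] {ι : Type*} [Finite ι]
    (I : ι → Ideal R) {d : WithBot ℕ∞} (h : ∀ i, ringKrullDim (R ⧸ I i) ≤ d) :
    ringKrullDim (R ⧸ ⨅ i, I i) ≤ d := by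
  cases nonempty_fintype ι
  rw [ringKrullDim_quotient, Order.krullDim]
  refine iSup_le fun l => ?_
  have h0 : (Finset.univ.inf I) ≤ l.head.1.asIdeal := by
    rw [Finset.inf_univ_eq_iInf]
    exact l.head.2
  obtain ⟨i, -, hi⟩ := (Ideal.IsPrime.inf_le' (l.head.1.2)).mp h0
  refine le_trans ?_ (h i)
  rw [ringKrullDim_quotient]
  let l' : LTSeries (PrimeSpectrum.zeroLocus (R := R) (I i)) :=
    { length := l.length
      toFun := fun j => ⟨(l j).1, hi.trans (show l.head.1 ≤ (l j).1 from l.head_le j)⟩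
      step := fun j => l.step j }
  exact Order.LTSeries.length_le_krullDim l'

end KrullDimension

section Cayley

variable {n : Type} [Fintype n] [DecidableEq n] {r : ℕ}

/-- The general member `∑ yₖ bₖ` of the linear space spanned by the matrices `bₖ`. -/
def genericMatrix (b : Fin r → Matrix n n ℂ) : Matrix n n (MvPolynomial (Fin r) ℂ) :=
  Matrix.of fun i j => ∑ k, MvPolynomial.C (b k i j) * MvPolynomial.X k

def cayleyDenom (b : Fin r → Matrix n n ℂ) : MvPolynomial (Fin r) ℂ :=
  (1 + genericMatrix b).det

/-- The coordinate ring of the open subset of `ℂʳ` where `1 + ∑ yₖ bₖ` is invertible. -/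
abbrev CayleyRing (b : Fin r → Matrix n n ℂ) : Type := Localization.Away (cayleyDenom b)

def genericUnit (b : Fin r → Matrix n n ℂ) : Matrix n n (CayleyRing b) :=
  (1 + genericMatrix b).map (algebraMap _ _)

/-- The homomorphism of rings of functions that belongs to `y ↦ g (1 - B) (1 + B)⁻¹`, where
`B = ∑ yₖ bₖ`. -/
def cayleyHom (g : Matrix n n ℂ) (b : Fin r → Matrix n n ℂ) :
    MvPolynomial (n × n) ℂ →ₐ[ℂ] CayleyRing b :=
  MvPolynomial.aeval fun p =>
    (g.map (algebraMap ℂ (CayleyRing b)) * (2 - genericUnit b) * (genericUnit b)⁻¹) p.1 p.2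

omit [Fintype n] [DecidableEq n] in
theorem map_eval_genericMatrix (b : Fin r → Matrix n n ℂ) (y : Fin r → ℂ) :
    (genericMatrix b).map (MvPolynomial.eval y) = ∑ k, y k • b k := by
  ext i j
  simp [genericMatrix, Matrix.sum_apply, mul_comm]

theorem eval_cayleyDenom (b : Fin r → Matrix n n ℂ) (y : Fin r → ℂ) :
    MvPolynomial.eval y (cayleyDenom b) = (1 + ∑ k, y k • b k).det := by
  rw [cayleyDenom, RingHom.map_det, RingHom.mapMatrix_apply,
    Matrix.map_add _ (map_add _), map_eval_genericMatrix]
  simp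

theorem cayleyDenom_ne_zero (b : Fin r → Matrix n n ℂ) : cayleyDenom b ≠ 0 := by
  intro h
  have := eval_cayleyDenom b 0
  simp [h] at this

instance (b : Fin r → Matrix n n ℂ) : IsDomain (CayleyRing b) :=
  IsLocalization.isDomain_localization
    (powers_le_nonZeroDivisors_of_noZeroDivisors (cayleyDenom_ne_zero b))

theorem algebraMap_cayleyRing_injective (b : Fin r → Matrix n n ℂ) :
    Function.Injective (algebraMap (MvPolynomial (Fin r) ℂ) (CayleyRing b)) :=
  IsLocalization.injective _
    (powers_le_nonZeroDivisors_of_noZeroDivisors (cayleyDenom_ne_zero b))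

theorem det_genericUnit (b : Fin r → Matrix n n ℂ) :
    (genericUnit b).det = algebraMap _ _ (cayleyDenom b) := by
  exact (RingHom.map_det (algebraMap (MvPolynomial (Fin r) ℂ) (CayleyRing b)) _).symm

theorem isUnit_det_genericUnit (b : Fin r → Matrix n n ℂ) : IsUnit (genericUnit b).det := by
  rw [det_genericUnit]
  exact IsLocalization.Away.algebraMap_isUnit _

/-- Evaluation at a point of the open set where `1 + ∑ yₖ bₖ` is invertible. -/
def cayleyEval (b : Fin r → Matrix n n ℂ) (y : Fin r → ℂ)
    (hy : (1 + ∑ k, y k • b k).det ≠ 0) : CayleyRing b →+* ℂ :=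
  IsLocalization.Away.lift (cayleyDenom b) (g := MvPolynomial.eval y)
    (by rw [eval_cayleyDenom]; exact hy.isUnit)

theorem cayleyEval_algebraMap (b : Fin r → Matrix n n ℂ) (y : Fin r → ℂ)
    (hy : (1 + ∑ k, y k • b k).det ≠ 0) (p : MvPolynomial (Fin r) ℂ) :
    cayleyEval b y hy (algebraMap _ _ p) = MvPolynomial.eval y p :=
  IsLocalization.Away.lift_eq _ _ _

theorem cayleyEval_algebraMap_complex (b : Fin r → Matrix n n ℂ) (y : Fin r → ℂ)
    (hy : (1 + ∑ k, y k • b k).det ≠ 0) (c : ℂ) :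
    cayleyEval b y hy (algebraMap ℂ _ c) = c := by
  rw [IsScalarTower.algebraMap_apply ℂ (MvPolynomial (Fin r) ℂ) (CayleyRing b),
    cayleyEval_algebraMap]
  simp

theorem map_cayleyEval_genericUnit (b : Fin r → Matrix n n ℂ) (y : Fin r → ℂ)
    (hy : (1 + ∑ k, y k • b k).det ≠ 0) :
    (cayleyEval b y hy).mapMatrix (genericUnit b) = 1 + ∑ k, y k • b k := by
  rw [← map_eval_genericMatrix]
  ext i j
  simp only [RingHom.mapMatrix_apply, Matrix.map_apply, genericUnit, cayleyEval_algebraMap]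
  simp [Matrix.one_apply, apply_ite]

theorem map_cayleyEval_genericUnit_inv (b : Fin r → Matrix n n ℂ) (y : Fin r → ℂ)
    (hy : (1 + ∑ k, y k • b k).det ≠ 0) :
    (cayleyEval b y hy).mapMatrix (genericUnit b)⁻¹ = (1 + ∑ k, y k • b k)⁻¹ := by
  refine (Matrix.inv_eq_right_inv ?_).symm
  rw [← map_cayleyEval_genericUnit b y hy, ← map_mul,
    Matrix.mul_nonsing_inv _ (isUnit_det_genericUnit b), map_one]

theorem cayleyEval_cayleyHom (g : Matrix n n ℂ) (b : Fin r → Matrix n n ℂ) (y : Fin r → ℂ)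
    (hy : (1 + ∑ k, y k • b k).det ≠ 0) (p : MvPolynomial (n × n) ℂ) :
    cayleyEval b y hy (cayleyHom g b p) = MvPolynomial.aeval (fun q : n × n =>
      (g * (1 - ∑ k, y k • b k) * (1 + ∑ k, y k • b k)⁻¹) q.1 q.2) p := by
  suffices h : (cayleyEval b y hy).comp (cayleyHom g b).toRingHom =
      (MvPolynomial.aeval (fun q : n × n =>
        (g * (1 - ∑ k, y k • b k) * (1 + ∑ k, y k • b k)⁻¹) q.1 q.2) :
        MvPolynomial (n × n) ℂ →ₐ[ℂ] ℂ).toRingHom from congrArg (fun f => f p) h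
  refine MvPolynomial.ringHom_ext (fun c => ?_) (fun q => ?_)
  · simp only [AlgHom.toRingHom_eq_coe, RingHom.coe_comp, RingHom.coe_coe, Function.comp_apply]
    rw [← MvPolynomial.algebraMap_eq, AlgHom.commutes, AlgHom.commutes,
      cayleyEval_algebraMap_complex]
    rfl
  · simp only [AlgHom.toRingHom_eq_coe, RingHom.coe_comp, RingHom.coe_coe, Function.comp_apply,
      cayleyHom, MvPolynomial.aeval_X]
    have h1 : (cayleyEval b y hy).mapMatrix (g.map (algebraMap ℂ (CayleyRing b)) *
        (2 - genericUnit b) * (genericUnit b)⁻¹) =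
        g * (1 - ∑ k, y k • b k) * (1 + ∑ k, y k • b k)⁻¹ := by
      rw [map_mul, map_mul, map_sub, map_cayleyEval_genericUnit, map_cayleyEval_genericUnit_inv]
      congr 2
      · ext i j
        simp [cayleyEval_algebraMap_complex]
      · rw [map_ofNat, ← one_add_one_eq_two]
        abel
    rw [← h1]
    rfl

theorem eq_zero_of_cayleyEval (b : Fin r → Matrix n n ℂ) (z : CayleyRing b)
    (hz : ∀ y hy, cayleyEval b y hy z = 0) : z = 0 := by
  obtain ⟨⟨a, s⟩, hs⟩ := IsLocalization.surj (Submonoid.powers (cayleyDenom b)) z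
  have ha : a * cayleyDenom b = 0 := by
    refine MvPolynomial.funext fun y => ?_
    rw [map_mul, map_zero, eval_cayleyDenom]
    by_cases hy : (1 + ∑ k, y k • b k).det = 0
    · rw [hy, mul_zero]
    · rw [← cayleyEval_algebraMap b y hy a, ← hs, map_mul, hz, zero_mul, zero_mul]
  have ha' : a = 0 := (mul_eq_zero.mp ha).resolve_right (cayleyDenom_ne_zero b)
  rw [ha', map_zero] at hs
  exact ((IsLocalization.map_units _ s).mul_left_eq_zero).mp hs

theorem trdeg_cayleyRing (b : Fin r → Matrix n n ℂ) : Algebra.trdeg ℂ (CayleyRing b) = r := by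
  have : FaithfulSMul (MvPolynomial (Fin r) ℂ) (CayleyRing b) :=
    (faithfulSMul_iff_algebraMap_injective _ _).mpr (algebraMap_cayleyRing_injective b)
  have : Algebra.IsAlgebraic (MvPolynomial (Fin r) ℂ) (CayleyRing b) :=
    IsLocalization.isAlgebraic _ (Submonoid.powers (cayleyDenom b))
  have h1 := _root_.trdeg_add_eq ℂ (MvPolynomial (Fin r) ℂ) (A := CayleyRing b)
  rw [_root_.trdeg_eq_zero (R := MvPolynomial (Fin r) ℂ), add_zero,
    MvPolynomial.trdeg_of_isDomain] at h1
  rw [← h1]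
  simp

/-- The set of the matrices `g (1 - B) (1 + B)⁻¹`, where `B` runs through a linear space. -/
def cayleyImage (g : Matrix n n ℂ) (V : Submodule ℂ (Matrix n n ℂ)) : Set (Matrix n n ℂ) :=
  {M | ∃ B ∈ V, (1 + B).det ≠ 0 ∧ M = g * (1 - B) * (1 + B)⁻¹}

theorem vanishingIdeal_cayleyImage (g : Matrix n n ℂ) (V : Submodule ℂ (Matrix n n ℂ))
    (b : Module.Basis (Fin r) ℂ V) :
    MvPolynomial.vanishingIdeal ℂ
      ((fun (M : Matrix n n ℂ) (p : n × n) => M p.1 p.2) '' cayleyImage g V) =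
    RingHom.ker (cayleyHom g fun k => (b k : Matrix n n ℂ)) := by
  ext p
  rw [MvPolynomial.mem_vanishingIdeal_iff, RingHom.mem_ker]
  constructor
  · intro h
    refine eq_zero_of_cayleyEval _ _ fun y hy => ?_
    rw [cayleyEval_cayleyHom]
    exact h _ ⟨_, ⟨_, Submodule.sum_mem _ fun k _ => Submodule.smul_mem _ _ (b k).2, hy, rfl⟩, rfl⟩
  · rintro h _ ⟨_, ⟨B, hB, hdet, rfl⟩, rfl⟩
    have hBy : ∑ k, b.repr ⟨B, hB⟩ k • (b k : Matrix n n ℂ) = B := by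
      have := congrArg Subtype.val (b.sum_repr ⟨B, hB⟩)
      simpa only [Submodule.coe_sum, Submodule.coe_smul] using this
    have h1 := cayleyEval_cayleyHom g (fun k => (b k : Matrix n n ℂ)) (b.repr ⟨B, hB⟩)
      (by rwa [hBy]) p
    rw [h, map_zero] at h1
    simp only [hBy] at h1
    exact h1.symm

theorem genericMatrix_entries_generate (b : Fin r → Matrix n n ℂ) (hb : LinearIndependent ℂ b)
    (k : Fin r) : ∃ c : n → n → ℂ,
      MvPolynomial.X k = ∑ i, ∑ j, MvPolynomial.C (c i j) * genericMatrix b i j := by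
  obtain ⟨f, hf⟩ : ∃ f : Matrix n n ℂ →ₗ[ℂ] ℂ, ∀ l, f (b l) = if l = k then 1 else 0 := by
    obtain ⟨f, hf⟩ := LinearMap.exists_extend (Finsupp.lapply k ∘ₗ hb.repr)
    refine ⟨f, fun l => ?_⟩
    have h1 := LinearMap.congr_fun hf ⟨b l, Submodule.subset_span ⟨l, rfl⟩⟩
    simp only [LinearMap.comp_apply, Submodule.subtype_apply] at h1
    rw [h1]
    have h2 := hb.repr_eq_single l ⟨b l, Submodule.subset_span ⟨l, rfl⟩⟩ rfl
    simp [h2, Finsupp.single_apply]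
  refine ⟨fun i j => f (Matrix.single i j 1), ?_⟩
  have hfb : ∀ l, ∑ i, ∑ j, f (Matrix.single i j 1) * b l i j = if l = k then 1 else 0 := by
    intro l
    rw [← hf l]
    conv_rhs => rw [Matrix.matrix_eq_sum_single (b l)]
    simp only [map_sum]
    refine Finset.sum_congr rfl fun i _ => Finset.sum_congr rfl fun j _ => ?_
    rw [← mul_one (b l i j), ← smul_eq_mul (b l i j) 1, ← Matrix.smul_single, map_smul]
    simp [mul_comm]
  calc (MvPolynomial.X k : MvPolynomial (Fin r) ℂ) =
        ∑ l, MvPolynomial.C (if l = k then 1 else 0) * MvPolynomial.X l := by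
        simp
    _ = _ := by
        simp_rw [← hfb, genericMatrix, Matrix.of_apply, map_sum, Finset.sum_mul, Finset.mul_sum]
        rw [Finset.sum_comm]
        refine Finset.sum_congr rfl fun i _ => ?_
        rw [Finset.sum_comm]
        simp [mul_assoc]

theorem isAlgebraic_cayleyRing {g : Matrix n n ℂ} (hg : g.det ≠ 0) {b : Fin r → Matrix n n ℂ}
    (hb : LinearIndependent ℂ b) {A : Type} [CommRing A] [IsDomain A] [Algebra A (CayleyRing b)]
    [Algebra ℂ A] [IsScalarTower ℂ A (CayleyRing b)]
    (hinj : Function.Injective (algebraMap A (CayleyRing b)))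
    (hrange : ∀ p, cayleyHom g b p ∈ Set.range (algebraMap A (CayleyRing b))) :
    Algebra.IsAlgebraic A (CayleyRing b) := by
  obtain ⟨Z, hZ⟩ : ∃ Z : Matrix n n A,
      Z.map (algebraMap A (CayleyRing b)) * genericUnit b = 2 := by
    choose x hx using fun q : n × n => hrange (MvPolynomial.X q)
    refine ⟨1 + (g⁻¹).map (algebraMap ℂ A) * Matrix.of fun i j => x (i, j), ?_⟩
    have h1 : (Matrix.of fun i j => x (i, j)).map (algebraMap A (CayleyRing b)) =
        g.map (algebraMap ℂ (CayleyRing b)) * (2 - genericUnit b) * (genericUnit b)⁻¹ := by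
      ext i j
      simp [hx, cayleyHom]
    have h2 : (g⁻¹).map (algebraMap ℂ (CayleyRing b)) * g.map (algebraMap ℂ (CayleyRing b)) =
        1 := by
      rw [← Matrix.map_mul, Matrix.nonsing_inv_mul _ hg.isUnit]
      simp
    have h3 : ((g⁻¹).map (algebraMap ℂ A)).map (algebraMap A (CayleyRing b)) =
        (g⁻¹).map (algebraMap ℂ (CayleyRing b)) := by
      ext i j
      simp [← IsScalarTower.algebraMap_apply]
    rw [Matrix.map_add _ (map_add _), Matrix.map_mul, h3, h1, Matrix.mul_assoc,
      ← Matrix.mul_assoc (Matrix.map _ _), h2, Matrix.one_mul, Matrix.add_mul, Matrix.mul_assoc,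
      Matrix.nonsing_inv_mul _ (isUnit_det_genericUnit b)]
    simp
  have hdet : Z.det ≠ 0 := by
    intro h
    have h1 := congrArg Matrix.det hZ
    have h2 : (2 : Matrix n n (CayleyRing b)) = (2 : CayleyRing b) • 1 := by
      rw [← Matrix.diagonal_ofNat, Matrix.smul_one_eq_diagonal]
    have h3 : (Z.map (algebraMap A (CayleyRing b))).det = 0 := by
      have := RingHom.map_det (algebraMap A (CayleyRing b)) Z
      rw [RingHom.mapMatrix_apply] at this
      rw [← this, h, map_zero]
    rw [Matrix.det_mul, h3, zero_mul, h2, Matrix.det_smul, Matrix.det_one, mul_one] at h1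
    have h4 : (2 : CayleyRing b) = 0 := eq_zero_of_pow_eq_zero h1.symm
    have h5 : algebraMap ℂ (CayleyRing b) 2 = 0 := by rw [map_ofNat, h4]
    exact two_ne_zero ((algebraMap ℂ (CayleyRing b)).injective (h5.trans (map_zero _).symm))
  have hreg : algebraMap A (CayleyRing b) Z.det ∈ nonZeroDivisors (CayleyRing b) :=
    mem_nonZeroDivisors_of_ne_zero fun h => hdet (hinj (h.trans (map_zero _).symm))
  have hentry : ∀ i j, IsAlgebraic A (genericUnit b i j) := by
    intro i j
    refine IsAlgebraic.of_mul hreg (isAlgebraic_algebraMap _) ?_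
    have h1 : Z.adjugate.map (algebraMap A (CayleyRing b)) *
        Z.map (algebraMap A (CayleyRing b)) = (algebraMap A (CayleyRing b) Z.det) • 1 := by
      rw [← Matrix.map_mul, Matrix.adjugate_mul]
      ext i j
      by_cases hij : i = j <;> simp [hij]
    have h2 : algebraMap A (CayleyRing b) Z.det * genericUnit b i j =
        algebraMap A (CayleyRing b) (Z.adjugate i j * 2) := by
      have h3 := congrArg (fun M => (Z.adjugate.map (algebraMap A (CayleyRing b)) * M) i j) hZ
      simp only [← Matrix.mul_assoc, h1] at h3
      rw [Matrix.smul_mul, Matrix.one_mul, Matrix.smul_apply, smul_eq_mul] at h3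
      rw [h3, ← Matrix.diagonal_ofNat, Matrix.mul_diagonal, map_mul, map_ofNat]
      rfl
    rw [h2]
    exact isAlgebraic_algebraMap _
  have hpoly : ∀ p : MvPolynomial (Fin r) ℂ, IsAlgebraic A (algebraMap _ (CayleyRing b) p) := by
    have hC : ∀ c : ℂ, IsAlgebraic A (algebraMap (MvPolynomial (Fin r) ℂ) (CayleyRing b)
        (MvPolynomial.C c)) := by
      intro c
      rw [← MvPolynomial.algebraMap_eq, ← IsScalarTower.algebraMap_apply,
        IsScalarTower.algebraMap_apply ℂ A]
      exact isAlgebraic_algebraMap _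
    have hgen : ∀ i j, IsAlgebraic A (algebraMap (MvPolynomial (Fin r) ℂ) (CayleyRing b)
        (genericMatrix b i j)) := by
      intro i j
      have h1 : algebraMap (MvPolynomial (Fin r) ℂ) (CayleyRing b) (genericMatrix b i j) =
          genericUnit b i j - algebraMap A (CayleyRing b) ((1 : Matrix n n A) i j) := by
        by_cases hij : i = j
        · subst hij
          simp [genericUnit]
        · simp [genericUnit, hij]
      rw [h1]
      exact (hentry i j).sub (isAlgebraic_algebraMap _)
    intro p
    induction p using MvPolynomial.induction_on with
    | C c => exact hC c
    | add p q hp hq => rw [map_add]; exact hp.add hq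
    | mul_X p k hp =>
      rw [map_mul]
      refine hp.mul ?_
      obtain ⟨c, hc⟩ := genericMatrix_entries_generate b hb k
      rw [hc, map_sum]
      refine Subalgebra.sum_mem (Subalgebra.algebraicClosure A (CayleyRing b)) fun i _ => ?_
      rw [map_sum]
      refine Subalgebra.sum_mem (Subalgebra.algebraicClosure A (CayleyRing b)) fun j _ => ?_
      rw [map_mul]
      exact (hC _).mul (hgen i j)
  refine ⟨fun z => ?_⟩
  obtain ⟨⟨a, s⟩, hs⟩ := IsLocalization.surj (Submonoid.powers (cayleyDenom b)) z
  refine IsAlgebraic.of_mul (IsLocalization.map_units (CayleyRing b) s).mem_nonZeroDivisors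
    (hpoly _) ?_
  rw [mul_comm, hs]
  exact hpoly _

theorem ringKrullDim_cayleyImage (g : Matrix n n ℂ) (hg : g.det ≠ 0)
    (V : Submodule ℂ (Matrix n n ℂ)) :
    ringKrullDim (MvPolynomial (n × n) ℂ ⧸ MvPolynomial.vanishingIdeal ℂ
      ((fun (M : Matrix n n ℂ) (p : n × n) => M p.1 p.2) '' cayleyImage g V)) =
    Module.finrank ℂ V := by
  let b := Module.finBasis ℂ V
  rw [vanishingIdeal_cayleyImage g V b]
  set b' : Fin (Module.finrank ℂ V) → Matrix n n ℂ := fun k => (b k : Matrix n n ℂ) with hb'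
  have : IsDomain (MvPolynomial (n × n) ℂ ⧸ RingHom.ker (cayleyHom g b')) :=
    (Ideal.Quotient.isDomain_iff_prime _).mpr (RingHom.ker_isPrime _)
  apply ringKrullDim_eq_of_trdeg_eq (k := ℂ)
  rw [← trdeg_cayleyRing b']
  let φ := Ideal.kerLiftAlg (cayleyHom g b')
  have hφ : Function.Injective φ := Ideal.kerLiftAlg_injective _
  algebraize [φ.toRingHom]
  set A := MvPolynomial (n × n) ℂ ⧸ RingHom.ker (cayleyHom g b')
  have : IsScalarTower ℂ A (CayleyRing b') := .of_algHom φ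
  have : FaithfulSMul A (CayleyRing b') := (faithfulSMul_iff_algebraMap_injective _ _).mpr hφ
  have halg : Algebra.IsAlgebraic A (CayleyRing b') := isAlgebraic_cayleyRing (b := b') hg
    (b.linearIndependent.map' V.subtype V.ker_subtype) hφ fun p => ⟨Ideal.Quotient.mk _ p, rfl⟩
  have h1 := _root_.trdeg_add_eq ℂ A (A := CayleyRing b')
  rwa [_root_.trdeg_eq_zero (R := A), add_zero] at h1

end Cayley

section CayleyTransform

variable {n : Type} [Fintype n] [DecidableEq n]

/-- The Lie algebra of the group of the matrices `A` with `Aᵗ F A = F` and `Aᵗ G A = G`. -/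
def lieStabilizer (F G : Matrix n n ℂ) : Submodule ℂ (Matrix n n ℂ) where
  carrier := {B | Bᵀ * F + F * B = 0 ∧ Bᵀ * G + G * B = 0}
  zero_mem' := by simp
  add_mem' := by
    rintro A B ⟨hA, hA'⟩ ⟨hB, hB'⟩
    constructor
    · calc _ = (Aᵀ * F + F * A) + (Bᵀ * F + F * B) := by
            rw [transpose_add, Matrix.add_mul, Matrix.mul_add]; abel
        _ = 0 := by rw [hA, hB, add_zero]
    · calc _ = (Aᵀ * G + G * A) + (Bᵀ * G + G * B) := by
            rw [transpose_add, Matrix.add_mul, Matrix.mul_add]; abel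
        _ = 0 := by rw [hA', hB', add_zero]
  smul_mem' := by
    rintro c B ⟨hB, hB'⟩
    constructor
    · rw [transpose_smul, Matrix.smul_mul, Matrix.mul_smul, ← smul_add, hB, smul_zero]
    · rw [transpose_smul, Matrix.smul_mul, Matrix.mul_smul, ← smul_add, hB', smul_zero]

theorem mem_lieStabilizer {F G B : Matrix n n ℂ} :
    B ∈ lieStabilizer F G ↔ Bᵀ * F + F * B = 0 ∧ Bᵀ * G + G * B = 0 :=
  Iff.rfl

theorem transpose_sub_mul_sub {Q B : Matrix n n ℂ} (h : Bᵀ * Q + Q * B = 0) :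
    (1 - B)ᵀ * Q * (1 - B) = (1 + B)ᵀ * Q * (1 + B) := by
  have : (1 + B)ᵀ * Q * (1 + B) - (1 - B)ᵀ * Q * (1 - B) =
      (Bᵀ * Q + Q * B) + (Bᵀ * Q + Q * B) := by
    rw [transpose_add, transpose_sub, transpose_one]
    noncomm_ring
  rw [h, add_zero, sub_eq_zero] at this
  exact this.symm

theorem cayley_preserves {Q B : Matrix n n ℂ} (h : Bᵀ * Q + Q * B = 0) (hB : (1 + B).det ≠ 0) :
    ((1 - B) * (1 + B)⁻¹)ᵀ * Q * ((1 - B) * (1 + B)⁻¹) = Q := by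
  have h1 : (1 + B) * (1 + B)⁻¹ = 1 := Matrix.mul_nonsing_inv _ hB.isUnit
  have h2 : ((1 + B)⁻¹)ᵀ * (1 + B)ᵀ = 1 := by rw [← transpose_mul, h1, transpose_one]
  calc _ = ((1 + B)⁻¹)ᵀ * ((1 - B)ᵀ * Q * (1 - B)) * (1 + B)⁻¹ := by
        rw [transpose_mul]; simp only [Matrix.mul_assoc]
    _ = (((1 + B)⁻¹)ᵀ * (1 + B)ᵀ) * Q * ((1 + B) * (1 + B)⁻¹) := by
        rw [transpose_sub_mul_sub h]; simp only [Matrix.mul_assoc]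
    _ = Q := by rw [h1, h2, Matrix.one_mul, Matrix.mul_one]

theorem det_cayley {G B : Matrix n n ℂ} (hG : G.det ≠ 0) (h : Bᵀ * G + G * B = 0)
    (hB : (1 + B).det ≠ 0) : ((1 - B) * (1 + B)⁻¹).det = 1 := by
  have h1 : G * (1 - B) = (1 + B)ᵀ * G := by
    rw [transpose_add, transpose_one, Matrix.mul_sub, Matrix.add_mul, eq_neg_of_add_eq_zero_left h]
    simp [sub_eq_add_neg]
  have h2 := congrArg det h1
  rw [det_mul, det_mul, det_transpose, mul_comm] at h2
  rw [det_mul, mul_right_cancel₀ hG h2, ← det_mul, Matrix.mul_nonsing_inv _ hB.isUnit, det_one]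

theorem one_add_cayley {A : Matrix n n ℂ} (hA : (1 + A).det ≠ 0) :
    1 + (1 - A) * (1 + A)⁻¹ = (2 : ℂ) • (1 + A)⁻¹ := by
  have h1 : (1 + A) * (1 + A)⁻¹ = 1 := Matrix.mul_nonsing_inv _ hA.isUnit
  calc _ = (1 + A) * (1 + A)⁻¹ + (1 - A) * (1 + A)⁻¹ := by rw [h1]
    _ = _ := by
      rw [← Matrix.add_mul, add_add_sub_cancel, Matrix.add_mul, Matrix.one_mul, two_smul]

theorem det_one_add_cayley_ne_zero {A : Matrix n n ℂ} (hA : (1 + A).det ≠ 0) :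
    (1 + (1 - A) * (1 + A)⁻¹).det ≠ 0 := by
  rw [one_add_cayley hA, det_smul, det_nonsing_inv, Ring.inverse_eq_inv]
  exact mul_ne_zero (pow_ne_zero _ two_ne_zero) (inv_ne_zero hA)

theorem cayley_cayley {A : Matrix n n ℂ} (hA : (1 + A).det ≠ 0) :
    (1 - (1 - A) * (1 + A)⁻¹) * (1 + (1 - A) * (1 + A)⁻¹)⁻¹ = A := by
  have h1 : (1 + A) * (1 + A)⁻¹ = 1 := Matrix.mul_nonsing_inv _ hA.isUnit
  have h2 : 1 - (1 - A) * (1 + A)⁻¹ = A * ((2 : ℂ) • (1 + A)⁻¹) := by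
    calc _ = (1 + A) * (1 + A)⁻¹ - (1 - A) * (1 + A)⁻¹ := by rw [h1]
      _ = _ := by
        rw [← Matrix.sub_mul, Matrix.mul_smul, ← Matrix.smul_mul]
        congr 1
        rw [two_smul]
        abel
  rw [h2, ← one_add_cayley hA, Matrix.mul_assoc,
    Matrix.mul_nonsing_inv _ (det_one_add_cayley_ne_zero hA).isUnit, Matrix.mul_one]

theorem cayley_skew {Q A : Matrix n n ℂ} (h : Aᵀ * Q * A = Q) (hA : (1 + A).det ≠ 0) :
    ((1 - A) * (1 + A)⁻¹)ᵀ * Q + Q * ((1 - A) * (1 + A)⁻¹) = 0 := by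
  have h1 : (1 + A) * (1 + A)⁻¹ = 1 := Matrix.mul_nonsing_inv _ hA.isUnit
  have h2 : ((1 + A)⁻¹)ᵀ * (1 + A)ᵀ = 1 := by rw [← transpose_mul, h1, transpose_one]
  have h3 : (1 - A)ᵀ * Q * (1 + A) + (1 + A)ᵀ * Q * (1 - A) = 0 := by
    have : (1 - A)ᵀ * Q * (1 + A) + (1 + A)ᵀ * Q * (1 - A) = (Q - Aᵀ * Q * A) +
        (Q - Aᵀ * Q * A) := by
      rw [transpose_add, transpose_sub, transpose_one]
      noncomm_ring
    rw [this, h, sub_self, add_zero]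
  calc _ = ((1 + A)⁻¹)ᵀ * (1 - A)ᵀ * Q * ((1 + A) * (1 + A)⁻¹) +
        (((1 + A)⁻¹)ᵀ * (1 + A)ᵀ) * Q * ((1 - A) * (1 + A)⁻¹) := by
        rw [h1, h2, transpose_mul, Matrix.mul_one, Matrix.one_mul]
    _ = ((1 + A)⁻¹)ᵀ * ((1 - A)ᵀ * Q * (1 + A) + (1 + A)ᵀ * Q * (1 - A)) * (1 + A)⁻¹ := by
        simp only [Matrix.mul_add (_)⁻¹ᵀ, Matrix.add_mul _ _ (_)⁻¹, Matrix.mul_assoc]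
    _ = 0 := by rw [h3, Matrix.mul_zero, Matrix.zero_mul]

theorem mem_cayleyImage_lieStabilizer {F G g M : Matrix n n ℂ} (hg : g.det ≠ 0)
    (hF : (g⁻¹ * M)ᵀ * F * (g⁻¹ * M) = F) (hG : (g⁻¹ * M)ᵀ * G * (g⁻¹ * M) = G)
    (hdet : (1 + g⁻¹ * M).det ≠ 0) : M ∈ cayleyImage g (lieStabilizer F G) := by
  refine ⟨(1 - g⁻¹ * M) * (1 + g⁻¹ * M)⁻¹, ⟨cayley_skew hF hdet, cayley_skew hG hdet⟩,
    det_one_add_cayley_ne_zero hdet, ?_⟩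
  rw [Matrix.mul_assoc, cayley_cayley hdet, ← Matrix.mul_assoc,
    Matrix.mul_nonsing_inv _ hg.isUnit, Matrix.one_mul]

end CayleyTransform

section FiniteCover

/-- The basic open sets `f_x ≠ 0` with `f_x(x) ≠ 0` cover `S`, and finitely many of them do. -/
theorem exists_finset_forall_exists_eval_ne_zero {k τ : Type*} [Field k] [Finite τ]
    (S : Set (τ → k)) (f : (τ → k) → MvPolynomial τ k)
    (hf : ∀ x ∈ S, MvPolynomial.eval x (f x) ≠ 0) :
    ∃ s : Finset (τ → k), ↑s ⊆ S ∧ ∀ x ∈ S, ∃ g ∈ s, MvPolynomial.eval x (f g) ≠ 0 := by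
  classical
  obtain ⟨t, htS, ht⟩ := (Submodule.fg_span_iff_fg_span_finset_subset (f '' S)).mp
    (IsNoetherian.noetherian (Ideal.span (f '' S)))
  obtain ⟨s, hsS, rfl⟩ := Finset.subset_set_image_iff.mp htS
  refine ⟨s, hsS, fun x hx => ?_⟩
  by_contra! hcon
  have h1 : f x ∈ Ideal.span (f '' S) := Ideal.subset_span ⟨x, hx, rfl⟩
  have h2 : Ideal.span (↑(s.image f) : Set (MvPolynomial τ k)) ≤
      RingHom.ker (MvPolynomial.eval x) := by
    rw [Ideal.span_le]
    intro p hp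
    simp only [Finset.coe_image, Set.mem_image] at hp
    obtain ⟨g, hg, rfl⟩ := hp
    exact hcon g hg
  have h3 : Ideal.span (f '' S) = Ideal.span (↑(s.image f) : Set (MvPolynomial τ k)) := ht
  rw [h3] at h1
  exact hf x hx (h2 h1)

variable {G : Matrix (Fin 6) (Fin 6) ℂ} {X : QuadraticComplex G} {F : Matrix (Fin 6) (Fin 6) ℂ}

theorem mem_stab_of_transport_eq (hX : X.pencil = Submodule.span ℂ {F, G}) {A : SO G}
    (hA : transport A.val F = F) : A ∈ X.stab := by
  apply QuadraticComplex.ext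
  change X.pencil.map (transport A.val).toLinearMap = X.pencil
  have hG : transport A.val G = G := (A⁻¹).2.2
  rw [hX, Submodule.map_span, Set.image_pair]
  simp [hA, hG]

theorem exists_transport_eq_of_mem_stab (hX : X.pencil = Submodule.span ℂ {F, G}) {A : SO G}
    (hA : A ∈ X.stab) : ∃ a b : ℂ, transport A.val F = a • F + b • G := by
  have h1 : X.pencil.map (transport A.val).toLinearMap = X.pencil :=
    congrArg QuadraticComplex.pencil hA
  have h2 : transport A.val F ∈ X.pencil := by
    rw [← h1]
    exact ⟨F, by rw [hX]; exact Submodule.subset_span (by simp), rfl⟩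
  rw [hX, Submodule.mem_span_pair] at h2
  obtain ⟨a, b, h⟩ := h2
  exact ⟨a, b, h.symm⟩

theorem not_mem_span_of_pencil_eq (hX : X.pencil = Submodule.span ℂ {F, G}) (b : ℂ) :
    F ≠ b • G := by
  rintro rfl
  have h1 : X.pencil ≤ Submodule.span ℂ {G} := by
    rw [hX, Submodule.span_le]
    rintro Q (rfl | rfl)
    · exact Submodule.smul_mem _ _ (Submodule.mem_span_singleton_self _)
    · exact Submodule.mem_span_singleton_self _
  have h2 := Submodule.finrank_mono h1
  have h3 := finrank_span_le_card (R := ℂ) ({G} : Set (Matrix (Fin 6) (Fin 6) ℂ))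
  rw [Set.toFinset_singleton, Finset.card_singleton] at h3
  rw [X.finrank_pencil] at h2
  omega

theorem eval_discriminant {n : ℕ} (F G : Matrix (Fin n) (Fin n) ℂ) (t : ℂ) :
    (discriminant F G).eval t = (F + t • G).det := by
  rw [discriminant, ← Polynomial.coe_evalRingHom, RingHom.map_det]
  congr 1
  ext i j
  simp [pencilMatrix, mul_comm t]

theorem pencilMatrix_eq_mul_charmatrix {n : ℕ} {F G : Matrix (Fin n) (Fin n) ℂ}
    (hG : G.det ≠ 0) : pencilMatrix F G = G.map C * charmatrix (-(G⁻¹ * F)) := by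
  have h1 : G * (G⁻¹ * F) = F := by
    rw [← Matrix.mul_assoc, Matrix.mul_nonsing_inv _ hG.isUnit, Matrix.one_mul]
  rw [charmatrix, Matrix.mul_sub, RingHom.mapMatrix_apply, ← Matrix.map_mul, Matrix.mul_neg, h1,
    pencilMatrix]
  ext i j
  simp [add_comm]

theorem discriminant_eq_mul_charpoly {n : ℕ} {F G : Matrix (Fin n) (Fin n) ℂ}
    (hG : G.det ≠ 0) : discriminant F G = C G.det * (-(G⁻¹ * F)).charpoly := by
  rw [discriminant, pencilMatrix_eq_mul_charmatrix hG, det_mul, charpoly, RingHom.map_det]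
  rfl

theorem discriminant_ne_zero {n : ℕ} {F G : Matrix (Fin n) (Fin n) ℂ} (hG : G.det ≠ 0) :
    discriminant F G ≠ 0 := by
  rw [discriminant_eq_mul_charpoly hG]
  exact mul_ne_zero (C_ne_zero.mpr hG) (charpoly_monic _).ne_zero

theorem exists_finite_transport_coeffs (hG : G.det ≠ 0) (hX : X.pencil = Submodule.span ℂ {F, G})
    {t₁ t₂ : ℂ} (ht : t₁ ≠ t₂) (h₁ : (discriminant F G).IsRoot t₁)
    (h₂ : (discriminant F G).IsRoot t₂) :
    ∃ K : Finset (ℂ × ℂ), ∀ A ∈ X.stab, ∃ κ ∈ K, transport A.val F = κ.1 • F + κ.2 • G := by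
  classical
  let R := (discriminant F G).roots.toFinset
  refine ⟨(R ×ˢ R).image fun u =>
    ((t₁ - t₂) / (u.1 - u.2), (t₁ - t₂) / (u.1 - u.2) * u.1 - t₁), fun A hA => ?_⟩
  obtain ⟨a, b, hab⟩ := exists_transport_eq_of_mem_stab hX hA
  have hAG : transport A.val G = G := (A⁻¹).2.2
  have ha : a ≠ 0 := by
    rintro rfl
    apply not_mem_span_of_pencil_eq hX b
    apply (transport A.val).injective
    rw [hab, map_smul, hAG, zero_smul, zero_add]
  have key : ∀ t, (discriminant F G).IsRoot t → (b + t) / a ∈ R := by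
    intro t h
    rw [Multiset.mem_toFinset, mem_roots (discriminant_ne_zero hG), IsRoot, eval_discriminant]
    rw [IsRoot, eval_discriminant] at h
    have h1 : transport A.val (F + t • G) = a • (F + ((b + t) / a) • G) := by
      rw [map_add, map_smul, hab, hAG, smul_add, smul_smul, mul_div_cancel₀ _ ha, add_smul]
      abel
    have h2 := congrArg det h1
    rw [transport_apply, det_mul, det_mul, h, det_smul, mul_zero, zero_mul] at h2
    exact (mul_eq_zero.mp h2.symm).resolve_left (pow_ne_zero _ ha)
  refine ⟨(a, b), Finset.mem_image.mpr ⟨((b + t₁) / a, (b + t₂) / a),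
    Finset.mem_product.mpr ⟨key _ h₁, key _ h₂⟩, ?_⟩, hab⟩
  have h3 : (b + t₁) / a - (b + t₂) / a = (t₁ - t₂) / a := by ring
  have h4 : (t₁ - t₂) / ((t₁ - t₂) / a) = a := by
    have := sub_ne_zero.mpr ht
    field_simp
  simp only [h3, h4, mul_div_cancel₀ _ ha, add_sub_cancel_right]

theorem transport_eq_self_iff {A : GL (Fin 6) ℂ} {Q : Matrix (Fin 6) (Fin 6) ℂ} :
    transport A Q = Q ↔ A.valᵀ * Q * A.val = Q := by
  rw [← LinearEquiv.eq_symm_apply, eq_comm]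
  rfl

theorem exists_finset_stab_cover (hG : G.det ≠ 0)
    (hX : X.pencil = Submodule.span ℂ {F, G})
    {t₁ t₂ : ℂ} (ht : t₁ ≠ t₂) (h₁ : (discriminant F G).IsRoot t₁)
    (h₂ : (discriminant F G).IsRoot t₂) :
    ∃ s : Finset (SO G), ↑s ⊆ (X.stab : Set (SO G)) ∧
      ∀ A ∈ X.stab, ∃ g ∈ s, transport (g⁻¹ * A).val F = F ∧
        (1 + (g⁻¹ * A).val.val).det ≠ 0 := by
  classical
  obtain ⟨s₁, hs₁, hcov₁⟩ : ∃ s : Finset (SO G), ↑s ⊆ (X.stab : Set (SO G)) ∧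
      ∀ A ∈ X.stab, ∃ g ∈ s, transport (g⁻¹ * A).val F = F := by
    obtain ⟨K, hK⟩ := exists_finite_transport_coeffs hG hX ht h₁ h₂
    have : ∀ κ : ℂ × ℂ, ∃ g ∈ X.stab, (∃ A ∈ X.stab, transport A.val F = κ.1 • F + κ.2 • G) →
        transport g.val F = κ.1 • F + κ.2 • G := by
      intro κ
      by_cases h : ∃ A ∈ X.stab, transport A.val F = κ.1 • F + κ.2 • G
      · obtain ⟨A, hA, hA'⟩ := h
        exact ⟨A, hA, fun _ => hA'⟩
      · exact ⟨1, one_mem _, fun h' => absurd h' h⟩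
    choose g hg hg' using this
    refine ⟨K.image g, ?_, fun A hA => ?_⟩
    · intro x hx
      obtain ⟨κ, -, rfl⟩ := Finset.mem_image.mp hx
      exact hg κ
    · obtain ⟨κ, hκ, hA'⟩ := hK A hA
      refine ⟨g κ, Finset.mem_image_of_mem _ hκ, ?_⟩
      rw [Subgroup.coe_mul, transport_mul, hA', ← hg' κ ⟨A, hA, hA'⟩, ← transport_mul,
        ← Subgroup.coe_mul, inv_mul_cancel]
      exact transport_one F
  obtain ⟨s₂, hs₂, hcov₂⟩ : ∃ s : Finset (SO G),
      (∀ g ∈ s, transport g.val F = F) ∧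
      ∀ A : SO G, transport A.val F = F → ∃ g ∈ s, (1 + (g⁻¹ * A).val.val).det ≠ 0 := by
    let ent : SO G → (Fin 6 × Fin 6 → ℂ) := fun A p => A.val.val p.1 p.2
    let f : (Fin 6 × Fin 6 → ℂ) → MvPolynomial (Fin 6 × Fin 6) ℂ := fun x =>
      (1 + ((Matrix.of fun i j => x (i, j))⁻¹).map MvPolynomial.C *
        Matrix.of fun i j => MvPolynomial.X (i, j)).det
    have hf : ∀ g A : SO G, MvPolynomial.eval (ent A) (f (ent g)) =
        (1 + (g⁻¹ * A).val.val).det := by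
      intro g A
      have h1 : (Matrix.of fun i j => ent g (i, j)) = g.val.val := rfl
      have h2 : (Matrix.of fun i j => (MvPolynomial.X (i, j) :
          MvPolynomial (Fin 6 × Fin 6) ℂ)).map (MvPolynomial.eval (ent A)) = A.val.val := by
        ext i j
        simp [ent]
      have h3 : (((g.val.val)⁻¹).map MvPolynomial.C).map (MvPolynomial.eval (ent A)) =
          (g⁻¹).val.val := by
        ext i j
        simp
      simp only [f]
      rw [RingHom.map_det, RingHom.mapMatrix_apply, Matrix.map_add _ (map_add _), Matrix.map_mul,
        h1, h2, h3]
      simp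
    obtain ⟨s, hs, hs'⟩ := exists_finset_forall_exists_eval_ne_zero
      (ent '' {A | transport A.val F = F}) f (by
        rintro _ ⟨A, -, rfl⟩
        rw [hf, inv_mul_cancel]
        have : (1 + (1 : Matrix (Fin 6) (Fin 6) ℂ)).det ≠ 0 := by
          rw [← two_smul ℂ (1 : Matrix (Fin 6) (Fin 6) ℂ), det_smul, det_one, mul_one]
          exact pow_ne_zero _ two_ne_zero
        exact this)
    obtain ⟨s', hs1, rfl⟩ := Finset.subset_set_image_iff.mp hs
    refine ⟨s', fun g hg => hs1 hg, fun A hA => ?_⟩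
    obtain ⟨_, hg, hne⟩ := hs' _ ⟨A, hA, rfl⟩
    obtain ⟨g, hg', rfl⟩ := Finset.mem_image.mp hg
    exact ⟨g, hg', by rwa [hf] at hne⟩
  refine ⟨s₁ * s₂, ?_, fun A hA => ?_⟩
  · intro x hx
    obtain ⟨a, ha, b, hb, rfl⟩ := Finset.mem_mul.mp hx
    exact mul_mem (hs₁ ha) (mem_stab_of_transport_eq hX (hs₂ b hb))
  · obtain ⟨g, hg, hgA⟩ := hcov₁ A hA
    obtain ⟨h, hh, hdet⟩ := hcov₂ _ hgA
    refine ⟨g * h, Finset.mul_mem_mul hg hh, ?_, ?_⟩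
    · rw [_root_.mul_inv_rev, mul_assoc, Subgroup.coe_mul, transport_mul, hgA]
      have := congrArg (transport (h⁻¹).val) (hs₂ h hh)
      rw [← transport_mul, ← Subgroup.coe_mul, inv_mul_cancel] at this
      exact this.symm.trans (transport_one F)
    · rwa [_root_.mul_inv_rev, mul_assoc]

theorem matrixSet_stab_eq_iUnion (hG : G.det ≠ 0) (hX : X.pencil = Submodule.span ℂ {F, G})
    {s : Finset (SO G)} (hs : ↑s ⊆ (X.stab : Set (SO G)))
    (hcov : ∀ A ∈ X.stab, ∃ g ∈ s, transport (g⁻¹ * A).val F = F ∧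
        (1 + (g⁻¹ * A).val.val).det ≠ 0) :
    matrixSet X.stab = ⋃ g : s, cayleyImage g.val.val.val (lieStabilizer F G) := by
  ext M
  rw [Set.mem_iUnion]
  constructor
  · rintro ⟨A, hA, rfl⟩
    obtain ⟨g, hg, hF, hdet⟩ := hcov A hA
    have h1 : (g⁻¹ * A).val.val = (g.val.val)⁻¹ * A.val.val := by simp
    refine ⟨⟨g, hg⟩, mem_cayleyImage_lieStabilizer ?_ ?_ ?_ ?_⟩
    · rw [g.2.1]; exact one_ne_zero
    · rw [← h1]; exact transport_eq_self_iff.mp hF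
    · rw [← h1]; exact (g⁻¹ * A).2.2
    · rwa [← h1]
  · rintro ⟨⟨g, hg⟩, B, ⟨hBF, hBG⟩, hdet, rfl⟩
    have hc : ((1 - B) * (1 + B)⁻¹).det = 1 := det_cayley hG hBG hdet
    let A : SO G := ⟨GeneralLinearGroup.mkOfDetNeZero _ (by rw [hc]; exact one_ne_zero),
      hc, cayley_preserves hBG hdet⟩
    refine ⟨g * A, mul_mem (hs hg) (mem_stab_of_transport_eq hX
      (transport_eq_self_iff.mpr (cayley_preserves hBF hdet))), ?_⟩
    rw [Matrix.mul_assoc]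
    rfl

theorem vanishingIdeal_iUnion {ι : Type*} (S : ι → Set (Matrix (Fin 6) (Fin 6) ℂ)) :
    vanishingIdeal (⋃ i, S i) = ⨅ i, vanishingIdeal (S i) := by
  ext p
  simp only [vanishingIdeal, Ideal.mem_iInf, MvPolynomial.mem_vanishingIdeal_iff, Set.image_iUnion,
    Set.mem_iUnion]
  exact ⟨fun h i x hx => h x ⟨i, hx⟩, fun h x ⟨i, hx⟩ => h i x hx⟩

/-- The stabilizer of a complex whose discriminant has at least two roots is, as a variety, of the
same dimension as the Lie algebra of its subgroup that fixes the pencil pointwise. -/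
theorem dim_stab_eq_finrank (hG : G.det ≠ 0) (hX : X.pencil = Submodule.span ℂ {F, G})
    {t₁ t₂ : ℂ} (ht : t₁ ≠ t₂) (h₁ : (discriminant F G).IsRoot t₁)
    (h₂ : (discriminant F G).IsRoot t₂) :
    dim X.stab = Module.finrank ℂ (lieStabilizer F G) := by
  obtain ⟨s, hs, hcov⟩ := exists_finset_stab_cover hG hX ht h₁ h₂
  have hdim : ∀ g : s, ringKrullDim (MvPolynomial (Fin 6 × Fin 6) ℂ ⧸
      vanishingIdeal (cayleyImage g.val.val.val (lieStabilizer F G))) =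
      Module.finrank ℂ (lieStabilizer F G) := fun g =>
    ringKrullDim_cayleyImage _ (by rw [g.val.2.1]; exact one_ne_zero) _
  rw [dim, matrixSet_stab_eq_iUnion hG hX hs hcov, vanishingIdeal_iUnion]
  apply le_antisymm
  · exact ringKrullDim_quotient_iInf_le _ fun g => (hdim g).le
  · obtain ⟨g, hg, -⟩ := hcov 1 (one_mem _)
    rw [← hdim ⟨g, hg⟩]
    have hle := iInf_le (fun g : s => vanishingIdeal
      (cayleyImage g.val.val.val (lieStabilizer F G))) ⟨g, hg⟩
    exact ringKrullDim_le_of_surjective (Ideal.Quotient.factor hle)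
      (Ideal.Quotient.factor_surjective hle)

end FiniteCover

section Commutant

variable {n : Type} [Fintype n] [DecidableEq n]

/-- The map `S ↦ F G⁻¹ S - S G⁻¹ F`; under `S = G B` its kernel is the commutant of `G⁻¹ F`. -/
def pencilCommutator (F G : Matrix n n ℂ) : Matrix n n ℂ →ₗ[ℂ] Matrix n n ℂ :=
  LinearMap.mulLeft ℂ (F * G⁻¹) - LinearMap.mulRight ℂ (G⁻¹ * F)

theorem pencilCommutator_apply (F G S : Matrix n n ℂ) :
    pencilCommutator F G S = F * G⁻¹ * S - S * (G⁻¹ * F) := rfl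

variable (n) in
def skewMatrices : Submodule ℂ (Matrix n n ℂ) :=
  LinearMap.ker ((Matrix.transposeLinearEquiv n n ℂ ℂ).toLinearMap + LinearMap.id)

variable (n) in
def symmMatrices : Submodule ℂ (Matrix n n ℂ) :=
  LinearMap.ker ((Matrix.transposeLinearEquiv n n ℂ ℂ).toLinearMap - LinearMap.id)

omit [Fintype n] [DecidableEq n] in
theorem mem_skewMatrices {S : Matrix n n ℂ} : S ∈ skewMatrices n ↔ Sᵀ = -S := by
  simp [skewMatrices, add_eq_zero_iff_eq_neg]

omit [Fintype n] [DecidableEq n] in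
theorem mem_symmMatrices {S : Matrix n n ℂ} : S ∈ symmMatrices n ↔ Sᵀ = S := by
  simp [symmMatrices, sub_eq_zero]

omit [Fintype n] [DecidableEq n] in
theorem disjoint_skew_symm : Disjoint (skewMatrices n) (symmMatrices n) := by
  rw [Submodule.disjoint_def]
  intro S h1 h2
  rw [mem_skewMatrices, mem_symmMatrices.mp h2] at h1
  ext i j
  exact self_eq_neg.mp (congrFun (congrFun h1 i) j)

omit [Fintype n] [DecidableEq n] in
theorem skew_part_add_symm_part (S : Matrix n n ℂ) :
    (2⁻¹ : ℂ) • (S - Sᵀ) + (2⁻¹ : ℂ) • (S + Sᵀ) = S := by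
  rw [← smul_add, sub_add_add_cancel, ← two_smul ℂ, smul_smul, inv_mul_cancel₀ two_ne_zero,
    one_smul]

omit [Fintype n] [DecidableEq n] in
theorem skew_part_mem (S : Matrix n n ℂ) : (2⁻¹ : ℂ) • (S - Sᵀ) ∈ skewMatrices n := by
  rw [mem_skewMatrices, transpose_smul, transpose_sub, transpose_transpose, ← smul_neg, neg_sub]

omit [Fintype n] [DecidableEq n] in
theorem symm_part_mem (S : Matrix n n ℂ) : (2⁻¹ : ℂ) • (S + Sᵀ) ∈ symmMatrices n := by
  rw [mem_symmMatrices, transpose_smul, transpose_add, transpose_transpose, add_comm]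

theorem finrank_skew_add_finrank_symm :
    Module.finrank ℂ (skewMatrices n) + Module.finrank ℂ (symmMatrices n) =
      Module.finrank ℂ (Matrix n n ℂ) := by
  rw [← Submodule.finrank_sup_add_finrank_inf_eq, disjoint_skew_symm.eq_bot, finrank_bot, add_zero]
  rw [show skewMatrices n ⊔ symmMatrices n = ⊤ from ?_, finrank_top]
  rw [eq_top_iff]
  intro S _
  rw [← skew_part_add_symm_part S]
  exact Submodule.add_mem_sup (skew_part_mem S) (symm_part_mem S)

/-- The bilinear form `tr (S G⁻¹ S' G⁻¹)`. -/
def traceForm (G : Matrix n n ℂ) : LinearMap.BilinForm ℂ (Matrix n n ℂ) :=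
  LinearMap.mk₂ ℂ (fun S S' => (S * G⁻¹ * S' * G⁻¹).trace)
    (fun A B S => by simp [Matrix.add_mul]) (fun c A S => by simp)
    (fun A B S => by simp [Matrix.add_mul, Matrix.mul_add]) (fun c A S => by simp)

theorem traceForm_apply (G S S' : Matrix n n ℂ) :
    traceForm G S S' = (S * G⁻¹ * S' * G⁻¹).trace := rfl

theorem traceForm_isSymm (G : Matrix n n ℂ) : (traceForm G).IsSymm := by
  refine ⟨fun S S' => ?_⟩
  rw [traceForm_apply, traceForm_apply, Matrix.mul_assoc, Matrix.trace_mul_comm,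
    ← Matrix.mul_assoc]

theorem traceForm_nondegenerate {G : Matrix n n ℂ} (hG : G.det ≠ 0) :
    (traceForm G).Nondegenerate := by
  refine (LinearMap.IsRefl.nondegenerate_iff_separatingLeft (traceForm_isSymm G).isRefl).mpr ?_
  intro S hS
  have h1 : (G * (G⁻¹ * S * G⁻¹)) * G = S := by
    rw [← Matrix.mul_assoc, ← Matrix.mul_assoc, Matrix.mul_nonsing_inv _ hG.isUnit,
      Matrix.one_mul, Matrix.mul_assoc, Matrix.nonsing_inv_mul _ hG.isUnit, Matrix.mul_one]
  have h2 : G⁻¹ * S * G⁻¹ = 0 := by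
    refine Matrix.ext_iff_trace_mul_right.mpr fun x => ?_
    have := hS x
    rw [traceForm_apply, Matrix.trace_mul_comm, ← Matrix.mul_assoc, ← Matrix.mul_assoc] at this
    rw [this, Matrix.zero_mul, trace_zero]
  rw [← h1, h2, Matrix.mul_zero, Matrix.zero_mul]

theorem traceForm_pencilCommutator (F G S S' : Matrix n n ℂ) :
    traceForm G (pencilCommutator F G S) S' = -traceForm G S (pencilCommutator F G S') := by
  rw [traceForm_apply, traceForm_apply, pencilCommutator_apply, pencilCommutator_apply,
    ← trace_neg]
  simp only [Matrix.sub_mul, Matrix.mul_sub, trace_sub, neg_sub]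
  congr 1
  · rw [Matrix.mul_assoc F, Matrix.mul_assoc F, Matrix.mul_assoc F, Matrix.mul_assoc F,
      Matrix.trace_mul_comm F, Matrix.mul_assoc G⁻¹, Matrix.mul_assoc G⁻¹, Matrix.mul_assoc G⁻¹,
      Matrix.mul_assoc G⁻¹, Matrix.trace_mul_comm G⁻¹]
    simp only [Matrix.mul_assoc]
  · simp only [Matrix.mul_assoc]

variable {F G : Matrix n n ℂ}

theorem pencilCommutator_transpose (hF : F.IsSymm) (hG : G.IsSymm) (S : Matrix n n ℂ) :
    (pencilCommutator F G S)ᵀ = -pencilCommutator F G Sᵀ := by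
  simp only [pencilCommutator_apply, transpose_sub, transpose_mul, transpose_nonsing_inv, hF.eq,
    hG.eq, neg_sub, Matrix.mul_assoc]

theorem traceForm_skew_symm (hG : G.IsSymm) {S R : Matrix n n ℂ} (hS : S ∈ skewMatrices n)
    (hR : R ∈ symmMatrices n) : traceForm G S R = 0 := by
  rw [mem_skewMatrices] at hS
  rw [mem_symmMatrices] at hR
  have h : traceForm G S R = -traceForm G S R := by
    conv_lhs => rw [traceForm_apply, ← trace_transpose]
    simp only [transpose_mul, transpose_nonsing_inv, hG.eq, hS, hR]
    rw [traceForm_apply, ← trace_neg]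
    simp only [Matrix.mul_neg, trace_neg, ← Matrix.mul_assoc]
    rw [Matrix.trace_mul_comm]
    simp only [Matrix.mul_assoc]
  exact self_eq_neg.mp h

theorem mem_symm_of_traceForm_skew (hG : G.IsSymm) (hdet : G.det ≠ 0) {R : Matrix n n ℂ}
    (h : ∀ S ∈ skewMatrices n, traceForm G S R = 0) : R ∈ symmMatrices n := by
  have h1 : (2⁻¹ : ℂ) • (R - Rᵀ) = 0 := by
    refine (traceForm_nondegenerate hdet).1 _ fun S => ?_
    have h2 : traceForm G ((2⁻¹ : ℂ) • (S - Sᵀ)) ((2⁻¹ : ℂ) • (R - Rᵀ)) = 0 := by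
      have h3 := h _ (skew_part_mem S)
      conv at h3 => lhs; rw [← skew_part_add_symm_part R]
      rwa [map_add, traceForm_skew_symm hG (skew_part_mem S) (symm_part_mem R), add_zero] at h3
    rw [← (traceForm_isSymm G).eq]
    conv_lhs => rw [← skew_part_add_symm_part S]
    rw [map_add, LinearMap.add_apply, h2, zero_add, ← (traceForm_isSymm G).eq]
    exact traceForm_skew_symm hG (skew_part_mem R) (symm_part_mem S)
  have h2 := skew_part_add_symm_part R
  rw [h1, zero_add] at h2
  rw [← h2]
  exact symm_part_mem R

theorem finrank_ker_symm_add_finrank_skew (hF : F.IsSymm) (hG : G.IsSymm) (hdet : G.det ≠ 0) :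
    Module.finrank ℂ ↥(LinearMap.ker (pencilCommutator F G) ⊓ symmMatrices n) +
        Module.finrank ℂ (skewMatrices n) =
      Module.finrank ℂ ↥(LinearMap.ker (pencilCommutator F G) ⊓ skewMatrices n) +
        Module.finrank ℂ (symmMatrices n) := by
  set L := pencilCommutator F G with hL
  have hLK : (skewMatrices n).map L ≤ symmMatrices n := by
    rintro _ ⟨S, hS, rfl⟩
    rw [mem_symmMatrices, pencilCommutator_transpose hF hG, mem_skewMatrices.mp hS, map_neg,
      neg_neg]
  have hLP : ∀ S ∈ symmMatrices n, L S ∈ skewMatrices n := by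
    intro S hS
    rw [mem_skewMatrices, pencilCommutator_transpose hF hG, mem_symmMatrices.mp hS]
  have horth : (traceForm G).orthogonal ((skewMatrices n).map L ⊔ skewMatrices n) =
      LinearMap.ker L ⊓ symmMatrices n := by
    ext R
    rw [LinearMap.BilinForm.mem_orthogonal_iff, Submodule.mem_inf, LinearMap.mem_ker]
    constructor
    · intro h
      have h1 : R ∈ symmMatrices n := mem_symm_of_traceForm_skew hG hdet fun S hS =>
        h S (Submodule.mem_sup_right hS)
      have h2 : L R ∈ symmMatrices n := by
        refine mem_symm_of_traceForm_skew hG hdet fun S hS => ?_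
        have := h (L S) (Submodule.mem_sup_left ⟨S, hS, rfl⟩)
        rw [hL, traceForm_pencilCommutator] at this
        exact neg_eq_zero.mp this
      exact ⟨Submodule.disjoint_def.mp disjoint_skew_symm _ (hLP R h1) h2, h1⟩
    · rintro ⟨h1, h2⟩ S hS
      obtain ⟨_, ⟨A, hA, rfl⟩, B, hB, rfl⟩ := Submodule.mem_sup.mp hS
      rw [map_add, LinearMap.add_apply,
        traceForm_skew_symm hG hB h2, hL, traceForm_pencilCommutator, ← hL, h1, map_zero,
        neg_zero, add_zero]
  have h1 := LinearMap.BilinForm.finrank_orthogonal (traceForm_nondegenerate hdet)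
    ((skewMatrices n).map L ⊔ skewMatrices n)
  rw [horth] at h1
  have h2 := Submodule.finrank_sup_add_finrank_inf_eq ((skewMatrices n).map L) (skewMatrices n)
  rw [((disjoint_skew_symm (n := n)).mono_right hLK).symm.eq_bot, finrank_bot, add_zero] at h2
  have h3 := LinearMap.finrank_range_add_finrank_ker (L.domRestrict (skewMatrices n))
  rw [LinearMap.range_domRestrict] at h3
  have h4 : Module.finrank ℂ (LinearMap.ker (L.domRestrict (skewMatrices n))) =
      Module.finrank ℂ ↥(LinearMap.ker L ⊓ skewMatrices n) := by
    rw [LinearMap.ker_domRestrict, ← Submodule.finrank_map_subtype_eq, Submodule.map_comap_subtype,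
      inf_comm]
  have h5 := finrank_skew_add_finrank_symm (n := n)
  have h6 := Submodule.finrank_le ((skewMatrices n).map L ⊔ skewMatrices n)
  omega

theorem finrank_symmMatrices (n : ℕ) : Module.finrank ℂ (symmMatrices (Fin n)) =
    Module.finrank ℂ (skewMatrices (Fin n)) + n := by
  let D : Matrix (Fin n) (Fin n) ℂ := diagonal fun i => (i : ℂ)
  have h := finrank_ker_symm_add_finrank_skew (F := D) (G := 1) (isSymm_diagonal _) isSymm_one
    (by simp)
  have hker : ∀ S, S ∈ LinearMap.ker (pencilCommutator D 1) → ∃ d, S = diagonal d := by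
    intro S hS
    refine ⟨fun i => S i i, ?_⟩
    ext i j
    by_cases hij : i = j
    · subst hij; simp
    · rw [diagonal_apply_ne _ hij]
      have h1 : pencilCommutator D 1 S i j = (0 : Matrix (Fin n) (Fin n) ℂ) i j := by
        rw [LinearMap.mem_ker.mp hS]
      simp only [pencilCommutator_apply, inv_one, Matrix.mul_one, Matrix.one_mul,
        Matrix.sub_apply, D, diagonal_mul, mul_diagonal,
          Matrix.zero_apply] at h1
      have h2 : ((i : ℂ) - (j : ℂ)) * S i j = 0 := by rw [← h1]; ring
      refine (mul_eq_zero.mp h2).resolve_left (sub_ne_zero.mpr fun h3 => hij ?_)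
      exact Fin.ext (by exact_mod_cast h3)
  have h1 : LinearMap.ker (pencilCommutator D 1) ⊓ skewMatrices (Fin n) = ⊥ := by
    rw [← disjoint_iff]
    refine (disjoint_skew_symm (n := Fin n)).symm.mono_left fun S hS => ?_
    obtain ⟨d, rfl⟩ := hker S hS
    exact mem_symmMatrices.mpr (diagonal_transpose d)
  have h2 : LinearMap.ker (pencilCommutator D 1) ⊓ symmMatrices (Fin n) =
      LinearMap.range (Matrix.diagonalLinearMap (Fin n) ℂ ℂ) := by
    ext S
    constructor
    · intro hS
      obtain ⟨d, rfl⟩ := hker S hS.1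
      exact ⟨d, rfl⟩
    · rintro ⟨d, rfl⟩
      refine ⟨?_, mem_symmMatrices.mpr (diagonal_transpose d)⟩
      simp [pencilCommutator_apply, D, mul_comm]
  have h3 : Module.finrank ℂ (LinearMap.range (Matrix.diagonalLinearMap (Fin n) ℂ ℂ)) = n := by
    rw [LinearMap.finrank_range_of_inj]
    · simp
    · exact Matrix.diagonal_injective
  rw [h1, h2, h3, finrank_bot] at h
  omega

theorem finrank_lieStabilizer (hG : G.IsSymm) (hdet : G.det ≠ 0) :
    Module.finrank ℂ (lieStabilizer F G) =
      Module.finrank ℂ ↥(LinearMap.ker (pencilCommutator F G) ⊓ skewMatrices n) := by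
  have h1 : G * G⁻¹ = 1 := Matrix.mul_nonsing_inv _ hdet.isUnit
  have h2 : G⁻¹ * G = 1 := Matrix.nonsing_inv_mul _ hdet.isUnit
  let f : Matrix n n ℂ →ₗ[ℂ] Matrix n n ℂ := LinearMap.mulLeft ℂ G
  have hf : Function.Injective f := fun A B h => by
    have := congrArg (G⁻¹ * ·) h
    simpa [f, ← Matrix.mul_assoc, h2] using this
  have hmap : (lieStabilizer F G).map f =
      LinearMap.ker (pencilCommutator F G) ⊓ skewMatrices n := by
    have key : ∀ B, B ∈ lieStabilizer F G ↔
        f B ∈ LinearMap.ker (pencilCommutator F G) ⊓ skewMatrices n := by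
      intro B
      change _ ↔ G * B ∈ _
      rw [Submodule.mem_inf, mem_skewMatrices, LinearMap.mem_ker, pencilCommutator_apply,
        mem_lieStabilizer, transpose_mul, hG.eq, add_eq_zero_iff_eq_neg (b := G * B)]
      refine and_congr_left fun h => ?_
      have h3 : Bᵀ * F = -(G * B * (G⁻¹ * F)) := by
        rw [← Matrix.neg_mul, ← h, ← Matrix.mul_assoc, Matrix.mul_assoc Bᵀ, h1, Matrix.mul_one]
      rw [h3, Matrix.mul_assoc F, ← Matrix.mul_assoc G⁻¹, h2, Matrix.one_mul, neg_add_eq_sub]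
    ext S
    constructor
    · rintro ⟨B, hB, rfl⟩
      exact (key B).mp hB
    · intro hS
      have hS' : f (G⁻¹ * S) = S := by
        change G * (G⁻¹ * S) = S
        rw [← Matrix.mul_assoc, h1, Matrix.one_mul]
      exact ⟨G⁻¹ * S, (key _).mpr (by rwa [hS']), hS'⟩
  rw [← hmap]
  exact (LinearEquiv.finrank_eq (Submodule.equivMapOfInjective f hf _))

/-- The commutant of `G⁻¹ F` has dimension `n + 2 dim`, where `dim` is that of its skew part. -/
theorem finrank_ker_pencilCommutator {n : ℕ} {F G : Matrix (Fin n) (Fin n) ℂ} (hF : F.IsSymm)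
    (hG : G.IsSymm) (hdet : G.det ≠ 0) :
    Module.finrank ℂ (LinearMap.ker (pencilCommutator F G)) =
      n + 2 * Module.finrank ℂ (lieStabilizer F G) := by
  rw [finrank_lieStabilizer hG hdet]
  have h1 := finrank_ker_symm_add_finrank_skew hF hG hdet
  have h2 := finrank_symmMatrices n
  set K := LinearMap.ker (pencilCommutator F G)
  have h3 := Submodule.finrank_sup_add_finrank_inf_eq (K ⊓ skewMatrices (Fin n))
    (K ⊓ symmMatrices (Fin n))
  rw [((disjoint_skew_symm (n := Fin n)).mono inf_le_right inf_le_right).eq_bot, finrank_bot,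
    add_zero] at h3
  have h4 : K ⊓ skewMatrices (Fin n) ⊔ K ⊓ symmMatrices (Fin n) = K := by
    apply le_antisymm (sup_le inf_le_left inf_le_left)
    intro S hS
    have hS' : Sᵀ ∈ K := by
      rw [LinearMap.mem_ker, ← neg_eq_zero, ← pencilCommutator_transpose hF hG,
        LinearMap.mem_ker.mp hS, transpose_zero]
    rw [← skew_part_add_symm_part S]
    exact Submodule.add_mem_sup ⟨K.smul_mem _ (K.sub_mem hS hS'), skew_part_mem S⟩
      ⟨K.smul_mem _ (K.add_mem hS hS'), symm_part_mem S⟩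
  rw [h4] at h3
  omega

end Commutant

section HomQuotients

variable {K : Type} [Field K]

/-- `Hom (K[t]/(a), K[t]/(b))` is isomorphic to `K[t]/(gcd a b)`. -/
theorem nonempty_hom_quotient_span_equiv [DecidableEq K] {a b : K[X]} (hb : b ≠ 0) :
    Nonempty ((K[X] ⧸ Ideal.span {gcd a b}) ≃ₗ[K[X]]
      ((K[X] ⧸ Ideal.span {a}) →ₗ[K[X]] (K[X] ⧸ Ideal.span {b}))) := by
  obtain ⟨a', ha⟩ := gcd_dvd_left a b
  obtain ⟨b', hb'⟩ := gcd_dvd_right a b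
  set g := gcd a b with hg
  have hg0 : g ≠ 0 := by
    rintro h
    rw [h, zero_mul] at hb'
    exact hb hb'
  have hb0 : b' ≠ 0 := by
    rintro h
    rw [h, mul_zero] at hb'
    exact hb hb'
  have hcop : IsCoprime a' b' := by
    obtain ⟨u, v, huv⟩ := exists_gcd_eq_mul_add_mul a b
    refine ⟨u, v, mul_left_cancel₀ hg0 ?_⟩
    rw [mul_one]
    conv_rhs => rw [hg, huv]
    conv_rhs => rw [ha, hb']
    ring
  let h₀ : (K[X] ⧸ Ideal.span {a}) →ₗ[K[X]] (K[X] ⧸ Ideal.span {b}) :=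
    Submodule.mapQ _ _ (LinearMap.mulLeft K[X] b') (by
      rw [Ideal.span, Submodule.span_le, Set.singleton_subset_iff]
      change b' * a ∈ Ideal.span {b}
      rw [Ideal.mem_span_singleton]
      exact ⟨a', by conv_lhs => rw [ha]
                    conv_rhs => rw [hb']
                    ring⟩)
  have h₀_one : ∀ x : K[X], (x • h₀) (Ideal.Quotient.mk _ 1) = Ideal.Quotient.mk _ (b' * x) := by
    intro x
    have h1 : h₀ (Ideal.Quotient.mk _ 1) = Ideal.Quotient.mk _ (b' * 1) := rfl
    rw [LinearMap.smul_apply, h1, mul_one, mul_comm]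
    rfl
  have hext : ∀ φ ψ : (K[X] ⧸ Ideal.span {a}) →ₗ[K[X]] (K[X] ⧸ Ideal.span {b}),
      φ (Ideal.Quotient.mk _ 1) = ψ (Ideal.Quotient.mk _ 1) → φ = ψ := by
    intro φ ψ h
    refine LinearMap.ext fun x => ?_
    obtain ⟨x, rfl⟩ := Ideal.Quotient.mk_surjective x
    have : (Ideal.Quotient.mk (Ideal.span {a})) x = x • Ideal.Quotient.mk _ 1 := by
      conv_lhs => rw [← mul_one x]
      rfl
    rw [this, map_smul, map_smul, h]
  let Ψ := LinearMap.toSpanSingleton K[X] _ h₀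
  have hker : LinearMap.ker Ψ = Ideal.span {g} := by
    ext x
    rw [LinearMap.mem_ker, Ideal.mem_span_singleton, LinearMap.toSpanSingleton_apply]
    have h1 : x • h₀ = 0 ↔ b ∣ b' * x := by
      rw [← Ideal.mem_span_singleton, ← Ideal.Quotient.eq_zero_iff_mem, ← h₀_one]
      exact ⟨fun h => by rw [h]; rfl, fun h => hext _ _ (by rw [h]; rfl)⟩
    rw [h1, mul_comm b' x]
    conv_lhs => rw [hb']
    exact mul_dvd_mul_iff_right hb0
  have hsurj : Function.Surjective Ψ := by
    intro φ
    obtain ⟨y, hy⟩ := Ideal.Quotient.mk_surjective (φ (Ideal.Quotient.mk _ 1))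
    have h1 : b ∣ a * y := by
      rw [← Ideal.mem_span_singleton, ← Ideal.Quotient.eq_zero_iff_mem]
      have h2 : a • (Ideal.Quotient.mk (Ideal.span {a})) 1 = 0 := by
        change Ideal.Quotient.mk (Ideal.span {a}) (a * 1) = 0
        rw [mul_one, Ideal.Quotient.eq_zero_iff_mem]
        exact Ideal.mem_span_singleton_self a
      have h3 : φ (a • (Ideal.Quotient.mk (Ideal.span {a})) 1) = 0 := by rw [h2, map_zero]
      rw [map_smul, ← hy] at h3
      exact h3
    rw [hb', ha, mul_assoc, mul_dvd_mul_iff_left hg0] at h1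
    obtain ⟨x, hx⟩ := hcop.symm.dvd_of_dvd_mul_left h1
    refine ⟨x, hext _ _ ?_⟩
    rw [LinearMap.toSpanSingleton_apply, h₀_one, ← hy, hx]
  exact ⟨(Submodule.quotEquivOfEq _ _ hker).symm.trans
    (LinearMap.quotKerEquivOfSurjective Ψ hsurj)⟩

/-- Homomorphisms into a product are families of homomorphisms. -/
def homPiEquiv (R : Type*) [CommRing R] {ι : Type*} (M : Type*) [AddCommGroup M] [Module R M]
    (Q : ι → Type*) [∀ i, AddCommGroup (Q i)] [∀ i, Module R (Q i)] :
    (M →ₗ[R] ∀ i, Q i) ≃ₗ[R] ∀ i, M →ₗ[R] Q i where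
  toFun f i := LinearMap.proj i ∘ₗ f
  invFun := LinearMap.pi
  map_add' _ _ := rfl
  map_smul' _ _ := rfl
  left_inv _ := rfl
  right_inv _ := rfl

end HomQuotients

section Cokernel

variable {n : ℕ} (T : Matrix (Fin n) (Fin n) ℂ)

def commutant : Submodule ℂ (Matrix (Fin n) (Fin n) ℂ) :=
  LinearMap.ker (LinearMap.mulLeft ℂ T - LinearMap.mulRight ℂ T)

variable {T} in
theorem mem_commutant {B : Matrix (Fin n) (Fin n) ℂ} : B ∈ commutant T ↔ T * B = B * T := by
  simp [commutant, sub_eq_zero]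

theorem finrank_ker_pencilCommutator_eq {F G : Matrix (Fin n) (Fin n) ℂ} (hG : G.det ≠ 0) :
    Module.finrank ℂ (LinearMap.ker (pencilCommutator F G)) =
      Module.finrank ℂ (commutant (-(G⁻¹ * F))) := by
  have h1 : G * G⁻¹ = 1 := Matrix.mul_nonsing_inv _ hG.isUnit
  have h2 : G⁻¹ * G = 1 := Matrix.nonsing_inv_mul _ hG.isUnit
  let f : Matrix (Fin n) (Fin n) ℂ →ₗ[ℂ] Matrix (Fin n) (Fin n) ℂ := LinearMap.mulLeft ℂ G
  have hf : Function.Injective f := fun A B h => by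
    have := congrArg (G⁻¹ * ·) h
    simpa [f, ← Matrix.mul_assoc, h2] using this
  have hmap : (commutant (-(G⁻¹ * F))).map f = LinearMap.ker (pencilCommutator F G) := by
    have key : ∀ B, pencilCommutator F G (G * B) = G * (G⁻¹ * F * B - B * (G⁻¹ * F)) := by
      intro B
      rw [pencilCommutator_apply, Matrix.mul_sub, Matrix.mul_assoc F, ← Matrix.mul_assoc G⁻¹ G,
        h2, Matrix.one_mul, ← Matrix.mul_assoc G (_ * _), ← Matrix.mul_assoc G G⁻¹, h1,
        Matrix.one_mul, ← Matrix.mul_assoc G B]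
    have hmem : ∀ B, B ∈ commutant (-(G⁻¹ * F)) ↔ G⁻¹ * F * B - B * (G⁻¹ * F) = 0 := by
      intro B
      rw [mem_commutant, Matrix.neg_mul, Matrix.mul_neg, neg_inj, sub_eq_zero]
    ext S
    constructor
    · rintro ⟨B, hB, rfl⟩
      change pencilCommutator F G (G * B) = 0
      rw [key, (hmem B).mp hB, Matrix.mul_zero]
    · intro hS
      have hS' : G * (G⁻¹ * S) = S := by rw [← Matrix.mul_assoc, h1, Matrix.one_mul]
      refine ⟨G⁻¹ * S, (hmem _).mpr ?_, hS'⟩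
      have h3 := key (G⁻¹ * S)
      rw [hS', LinearMap.mem_ker.mp hS] at h3
      have h4 := congrArg (G⁻¹ * ·) h3
      simpa [← Matrix.mul_assoc, h2] using h4.symm
  rw [← hmap]
  exact (LinearEquiv.finrank_eq (Submodule.equivMapOfInjective f hf _)).symm

abbrev charRange : Submodule ℂ[X] (Fin n → ℂ[X]) := LinearMap.range (charmatrix T).mulVecLin

abbrev OperatorModule : Type := Module.AEval' (Matrix.toLin' T)

/-- The presentation of `ℂⁿ` as a `ℂ[t]`-module, where `t` acts as `T`. -/
def presentation : (Fin n → ℂ[X]) →ₗ[ℂ[X]] OperatorModule T :=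
  Fintype.linearCombination ℂ[X] fun i => Module.AEval'.of (Matrix.toLin' T) (Pi.single i 1)

theorem presentation_apply (w : Fin n → ℂ[X]) :
    presentation T w = ∑ i, w i • Module.AEval'.of (Matrix.toLin' T) (Pi.single i 1) :=
  rfl

theorem presentation_C (v : Fin n → ℂ) :
    presentation T (fun i => C (v i)) = Module.AEval'.of (Matrix.toLin' T) v := by
  rw [presentation_apply]
  conv_rhs => rw [pi_eq_sum_univ' v]
  rw [map_sum]
  refine Finset.sum_congr rfl fun i _ => ?_
  rw [map_smul]
  exact Module.AEval.C_smul _ _ _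

theorem charmatrix_mulVec_C (v : Fin n → ℂ) :
    charmatrix T *ᵥ (fun i => C (v i)) =
      (X : ℂ[X]) • (fun i => C (v i)) - fun i => C ((T *ᵥ v) i) := by
  rw [charmatrix, Matrix.sub_mulVec]
  congr 1
  · rw [Matrix.scalar_apply]
    ext1 i
    rw [Matrix.mulVec_diagonal]
    rfl
  · ext1 i
    simp [Matrix.mulVec, dotProduct]

theorem charRange_le_ker_presentation : charRange T ≤ LinearMap.ker (presentation T) := by
  rw [LinearMap.range_le_ker_iff]
  refine LinearMap.pi_ext' fun i => LinearMap.ext_ring ?_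
  have h1 : (Pi.single i 1 : Fin n → ℂ[X]) = fun j => C ((Pi.single i 1 : Fin n → ℂ) j) := by
    ext1 j
    by_cases h : j = i
    · subst h; simp
    · simp [h]
  change presentation T (charmatrix T *ᵥ (Pi.single i 1)) = 0
  rw [h1, charmatrix_mulVec_C, map_sub, map_smul, presentation_C, presentation_C,
    Module.AEval'.X_smul_of, Matrix.toLin'_apply, sub_self]

theorem exists_const_sub_mem_charRange (w : Fin n → ℂ[X]) :
    ∃ v : Fin n → ℂ, (w - fun i => C (v i)) ∈ charRange T := by
  have hadd : ∀ w₁ w₂ : Fin n → ℂ[X], (∃ v : Fin n → ℂ, (w₁ - fun i => C (v i)) ∈ charRange T) →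
      (∃ v : Fin n → ℂ, (w₂ - fun i => C (v i)) ∈ charRange T) →
      ∃ v : Fin n → ℂ, (w₁ + w₂ - fun i => C (v i)) ∈ charRange T := by
    rintro w₁ w₂ ⟨v₁, h₁⟩ ⟨v₂, h₂⟩
    refine ⟨v₁ + v₂, ?_⟩
    convert (charRange T).add_mem h₁ h₂ using 1
    ext1 i
    simp only [Pi.add_apply, Pi.sub_apply, map_add]
    ring
  have hmono : ∀ (k : ℕ) (v : Fin n → ℂ), ∃ v' : Fin n → ℂ,
      (((X : ℂ[X]) ^ k • fun i => C (v i)) - fun i => C (v' i)) ∈ charRange T := by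
    intro k
    induction k with
    | zero => exact fun v => ⟨v, by simp⟩
    | succ k ih =>
      intro v
      obtain ⟨v', h⟩ := ih (T *ᵥ v)
      refine ⟨v', ?_⟩
      convert (charRange T).add_mem h ((charRange T).smul_mem (X ^ k)
        ⟨fun i => C (v i), rfl⟩) using 1
      rw [Matrix.mulVecLin_apply, charmatrix_mulVec_C, smul_sub, smul_smul, ← pow_succ]
      abel
  have hsingle : ∀ (p : ℂ[X]) (i : Fin n), ∃ v : Fin n → ℂ,
      ((Pi.single i p : Fin n → ℂ[X]) - fun i => C (v i)) ∈ charRange T := by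
    intro p i
    induction p using Polynomial.induction_on' with
    | add p q hp hq => rw [Pi.single_add]; exact hadd _ _ hp hq
    | monomial k c =>
      obtain ⟨v, h⟩ := hmono k (Pi.single i c)
      refine ⟨v, ?_⟩
      convert h using 2
      ext1 j
      by_cases hj : j = i
      · subst hj
        simp only [Pi.single_eq_same, Pi.smul_apply, smul_eq_mul]
        rw [← C_mul_X_pow_eq_monomial, mul_comm]
      · simp [hj]
  rw [← Finset.univ_sum_single w]
  induction (Finset.univ : Finset (Fin n)) using Finset.induction_on with
  | empty => exact ⟨0, by convert (charRange T).zero_mem; ext1 i; simp⟩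
  | insert a s ha ih => rw [Finset.sum_insert ha]; exact hadd _ _ (hsingle _ _) ih

theorem ker_presentation : LinearMap.ker (presentation T) = charRange T := by
  refine le_antisymm (fun w hw => ?_) (charRange_le_ker_presentation T)
  obtain ⟨v, hv⟩ := exists_const_sub_mem_charRange T w
  have h1 := charRange_le_ker_presentation T hv
  rw [LinearMap.mem_ker, map_sub, LinearMap.mem_ker.mp hw, presentation_C, zero_sub,
    neg_eq_zero, LinearEquiv.map_eq_zero_iff] at h1
  convert hv using 1
  subst h1
  ext1 i
  simp

theorem presentation_surjective : Function.Surjective (presentation T) := by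
  intro m
  obtain ⟨v, rfl⟩ := (Module.AEval'.of (Matrix.toLin' T)).surjective m
  exact ⟨_, presentation_C T v⟩

theorem finrank_charRange :
    Module.finrank ℂ[X] (charRange T) = Module.finrank ℂ[X] (Fin n → ℂ[X]) := by
  refine LinearMap.finrank_range_of_inj ?_
  refine Matrix.mulVec_injective_of_det_ne_zero ?_
  exact (charpoly_monic T).ne_zero

def smithCoeff : Fin n → ℂ[X] :=
  Submodule.smithNormalFormCoeffs (Pi.basisFun ℂ[X] (Fin n)) (finrank_charRange T)

theorem smithCoeff_ne_zero (i : Fin n) : smithCoeff T i ≠ 0 :=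
  Submodule.smithNormalFormCoeffs_ne_zero _ _ i

def operatorModuleEquiv :
    OperatorModule T ≃ₗ[ℂ[X]] ∀ i, ℂ[X] ⧸ Ideal.span {smithCoeff T i} :=
  ((LinearMap.quotKerEquivOfSurjective _ (presentation_surjective T)).symm.trans
    (Submodule.quotEquivOfEq _ _ (ker_presentation T))).trans
      ((charRange T).quotientEquivPiSpan (Pi.basisFun ℂ[X] (Fin n)) (finrank_charRange T))

theorem sum_natDegree_smithCoeff : ∑ i, (smithCoeff T i).natDegree = n := by
  have h1 := ((operatorModuleEquiv T).restrictScalars ℂ).finrank_eq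
  have h2 := (Module.AEval'.of (Matrix.toLin' T)).finrank_eq
  have : ∀ i, Module.Finite ℂ (ℂ[X] ⧸ Ideal.span {smithCoeff T i}) := fun i =>
    PowerBasis.finite (AdjoinRoot.powerBasis (smithCoeff_ne_zero T i))
  rw [Module.finrank_pi_fintype] at h1
  rw [← Finset.sum_congr rfl fun i _ => finrank_quotient_span_eq_natDegree (f := smithCoeff T i),
    ← h1]
  exact h2.symm.trans (Module.finrank_fin_fun ℂ)

theorem finrank_commutant_eq_finrank_end :
    Module.finrank ℂ (commutant T) =
      Module.finrank ℂ (OperatorModule T →ₗ[ℂ[X]] OperatorModule T) := by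
  let o := Module.AEval'.of (Matrix.toLin' T)
  let f : (OperatorModule T →ₗ[ℂ[X]] OperatorModule T) →ₗ[ℂ] Matrix (Fin n) (Fin n) ℂ :=
    { toFun := fun φ =>
        LinearMap.toMatrix' (o.symm.toLinearMap ∘ₗ φ.restrictScalars ℂ ∘ₗ o.toLinearMap)
      map_add' := fun φ ψ => by
        rw [← map_add]
        congr 1
      map_smul' := fun c φ => by
        rw [RingHom.id_apply, ← map_smul]
        congr 1 }
  have hf : ∀ φ v, f φ *ᵥ v = o.symm (φ (o v)) := by
    intro φ v
    change LinearMap.toMatrix' _ *ᵥ v = _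
    rw [LinearMap.toMatrix'_mulVec]
    rfl
  have hinj : Function.Injective f := by
    intro φ ψ h
    refine LinearMap.ext fun x => ?_
    obtain ⟨v, rfl⟩ := o.surjective x
    apply o.symm.injective
    rw [← hf, ← hf, h]
  have hrange : LinearMap.range f = commutant T := by
    ext B
    rw [mem_commutant]
    constructor
    · rintro ⟨φ, rfl⟩
      refine Matrix.ext_of_mulVec_single fun i => ?_
      rw [← Matrix.mulVec_mulVec, ← Matrix.mulVec_mulVec, hf, hf]
      apply o.injective
      have h1 := Module.AEval'.X_smul_of (Matrix.toLin' T) (o.symm (φ (o (Pi.single i 1))))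
      have h2 := Module.AEval'.X_smul_of (Matrix.toLin' T) (Pi.single i 1)
      rw [Matrix.toLin'_apply] at h1 h2
      change _ = o (T *ᵥ _) at h1
      change _ = o (T *ᵥ _) at h2
      rw [← h1, ← h2, map_smul]
      change (X : ℂ[X]) • (o (o.symm _)) = o (o.symm _)
      rw [o.apply_symm_apply, o.apply_symm_apply]
    · intro hB
      let φ : OperatorModule T →ₗ[ℂ[X]] OperatorModule T :=
        LinearMap.ofAEval (Matrix.toLin' T) (o.toLinearMap ∘ₗ Matrix.toLin' B) fun v => by
          change o (B *ᵥ (T *ᵥ v)) = (X : ℂ[X]) • o (B *ᵥ v)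
          rw [Module.AEval'.X_smul_of, Matrix.toLin'_apply, Matrix.mulVec_mulVec, ← hB,
            Matrix.mulVec_mulVec]
      refine ⟨φ, Matrix.ext_of_mulVec_single fun i => ?_⟩
      rw [hf]
      apply o.injective
      rw [o.apply_symm_apply]
      rfl
  rw [← hrange, LinearMap.finrank_range_of_inj hinj]

theorem finrank_commutant :
    Module.finrank ℂ (commutant T) =
      ∑ i, ∑ j, (gcd (smithCoeff T i) (smithCoeff T j)).natDegree := by
  rw [finrank_commutant_eq_finrank_end]
  let Q : Fin n → Type := fun i => ℂ[X] ⧸ Ideal.span {smithCoeff T i}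
  have e₁ : (OperatorModule T →ₗ[ℂ[X]] OperatorModule T) ≃ₗ[ℂ[X]]
      ((∀ i, Q i) →ₗ[ℂ[X]] ∀ i, Q i) :=
    LinearEquiv.arrowCongr (operatorModuleEquiv T) (operatorModuleEquiv T)
  have e₂ : ((∀ i, Q i) →ₗ[ℂ[X]] ∀ i, Q i) ≃ₗ[ℂ[X]] ∀ i, Q i →ₗ[ℂ[X]] ∀ j, Q j :=
    (LinearMap.lsum ℂ[X] Q ℂ[X]).symm
  have e₃ : (∀ i, Q i →ₗ[ℂ[X]] ∀ j, Q j) ≃ₗ[ℂ[X]] ∀ i j, Q i →ₗ[ℂ[X]] Q j :=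
    LinearEquiv.piCongrRight fun i => homPiEquiv ℂ[X] (Q i) Q
  have e₄ : (∀ i j, Q i →ₗ[ℂ[X]] Q j) ≃ₗ[ℂ[X]]
      ∀ i j, ℂ[X] ⧸ Ideal.span {gcd (smithCoeff T i) (smithCoeff T j)} :=
    LinearEquiv.piCongrRight fun i => LinearEquiv.piCongrRight fun j =>
      (nonempty_hom_quotient_span_equiv (smithCoeff_ne_zero T j)).some.symm
  have hfin : ∀ i j, Module.Finite ℂ
      (ℂ[X] ⧸ Ideal.span {gcd (smithCoeff T i) (smithCoeff T j)}) := fun i j =>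
    PowerBasis.finite (AdjoinRoot.powerBasis fun h =>
      smithCoeff_ne_zero T i ((gcd_eq_zero_iff _ _).mp h).1)
  rw [(((e₁.trans e₂).trans (e₃.trans e₄)).restrictScalars ℂ).finrank_eq,
    Module.finrank_pi_fintype]
  refine Finset.sum_congr rfl fun i _ => ?_
  rw [Module.finrank_pi_fintype]
  exact Finset.sum_congr rfl fun j _ => finrank_quotient_span_eq_natDegree

end Cokernel

section Minors

variable {R : Type*} [CommRing R] {n : ℕ}

/-- `d` divides all the minors of order `k`. -/
def DvdMinors (d : R) (k : ℕ) (A : Matrix (Fin n) (Fin n) R) : Prop :=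
  ∀ f g : Fin k ↪o Fin n, d ∣ (A.submatrix f g).det

theorem DvdMinors.dvd_of_fun {d : R} {k : ℕ} {A : Matrix (Fin n) (Fin n) R}
    (h : DvdMinors d k A) (φ : Fin k → Fin n) (g : Fin k ↪o Fin n) :
    d ∣ (A.submatrix φ g).det := by
  by_cases hφ : Function.Injective φ
  · have hmono : StrictMono (φ ∘ Tuple.sort φ) :=
      (Tuple.monotone_sort φ).strictMono_of_injective (hφ.comp (Tuple.sort φ).injective)
    have h1 := h (OrderEmbedding.ofStrictMono _ hmono) g
    have h2 : A.submatrix (OrderEmbedding.ofStrictMono _ hmono) g =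
        (A.submatrix φ g).submatrix (Tuple.sort φ) id := rfl
    rw [h2, Matrix.det_permute] at h1
    rcases Int.units_eq_one_or (Equiv.Perm.sign (Tuple.sort φ)) with hs | hs <;>
      simpa [hs] using h1
  · obtain ⟨i, j, hij, hne⟩ := Function.not_injective_iff.mp hφ
    rw [Matrix.det_zero_of_row_eq hne (by ext l; simp [hij])]
    exact dvd_zero d

theorem DvdMinors.mul_left {d : R} {k : ℕ} {A : Matrix (Fin n) (Fin n) R}
    (h : DvdMinors d k A) (P : Matrix (Fin n) (Fin n) R) : DvdMinors d k (P * A) := by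
  intro f g
  have h1 : (P * A).submatrix f g =
      Matrix.of fun i => ∑ l, P (f i) l • fun j => A l (g j) := by
    ext i j
    simp [Matrix.mul_apply]
  have h2 : ((P * A).submatrix f g).det = ∑ φ : Fin k → Fin n,
      (∏ i, P (f i) (φ i)) * (A.submatrix φ g).det := by
    rw [h1]
    have h3 := (Matrix.detRowAlternating (n := Fin k) (R := R)).toMultilinearMap.map_sum
      (fun i l => P (f i) l • fun j => A l (g j))
    refine h3.trans (Finset.sum_congr rfl fun φ _ => ?_)
    exact (Matrix.detRowAlternating (n := Fin k) (R := R)).toMultilinearMap.map_smul_univ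
      (fun i => P (f i) (φ i)) (fun i j => A (φ i) (g j))
  rw [h2]
  exact Finset.dvd_sum fun φ _ => Dvd.dvd.mul_left (h.dvd_of_fun φ g) _

theorem DvdMinors.transpose {d : R} {k : ℕ} {A : Matrix (Fin n) (Fin n) R}
    (h : DvdMinors d k A) : DvdMinors d k Aᵀ := by
  intro f g
  rw [← Matrix.det_transpose]
  exact h g f

theorem DvdMinors.mul_right {d : R} {k : ℕ} {A : Matrix (Fin n) (Fin n) R}
    (h : DvdMinors d k A) (Q : Matrix (Fin n) (Fin n) R) : DvdMinors d k (A * Q) := by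
  have := (h.transpose.mul_left Qᵀ).transpose
  rwa [← Matrix.transpose_mul, Matrix.transpose_transpose] at this

theorem dvdMinors_diagonal_iff {d : R} {k : ℕ} {a : Fin n → R} :
    DvdMinors d k (diagonal a) ↔ ∀ f : Fin k ↪o Fin n, d ∣ ∏ i, a (f i) := by
  have hdiag : ∀ f : Fin k ↪o Fin n, ((diagonal a).submatrix f f).det = ∏ i, a (f i) := by
    intro f
    have : (diagonal a).submatrix f f = diagonal (a ∘ f) :=
      Matrix.submatrix_diagonal a f f.injective
    rw [this, det_diagonal]
    rfl
  constructor
  · intro h f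
    rw [← hdiag]
    exact h f f
  · intro h f g
    by_cases hfg : f = g
    · subst hfg
      rw [hdiag]
      exact h f
    · suffices hrow : ∃ i, ∀ j, f i ≠ g j by
        obtain ⟨i, hi⟩ := hrow
        rw [Matrix.det_eq_zero_of_row_eq_zero i fun j => by
          rw [submatrix_apply, diagonal_apply_ne _ (hi j)]]
        exact dvd_zero d
      by_contra! hcon
      apply hfg
      have hsub : Set.range f ⊆ Set.range g := by
        rintro _ ⟨i, rfl⟩
        obtain ⟨j, hj⟩ := hcon i
        exact ⟨j, hj.symm⟩
      have heq : Set.range f = Set.range g := by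
        refine Set.eq_of_subset_of_ncard_le hsub ?_ (Set.toFinite _)
        rw [← Nat.card_coe_set_eq, ← Nat.card_coe_set_eq, Nat.card_range_of_injective g.injective,
          Nat.card_range_of_injective f.injective]
      exact OrderEmbedding.range_inj.mp heq

end Minors

section Smith

variable {n : ℕ} (T : Matrix (Fin n) (Fin n) ℂ)

theorem exists_smith_factorization (σ : Equiv.Perm (Fin n)) :
    (∃ P Q, charmatrix T = P * diagonal (smithCoeff T ∘ σ) * Q) ∧
      ∃ P Q, diagonal (smithCoeff T ∘ σ) = P * charmatrix T * Q := by
  let b := (Submodule.smithNormalFormTopBasis (Pi.basisFun ℂ[X] (Fin n))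
    (finrank_charRange T)).reindex σ.symm
  let c := (Submodule.smithNormalFormBotBasis (Pi.basisFun ℂ[X] (Fin n))
    (finrank_charRange T)).reindex σ.symm
  have hbc : ∀ i, (c i : Fin n → ℂ[X]) = smithCoeff T (σ i) • b i := by
    intro i
    simp only [c, b, Module.Basis.reindex_apply, Equiv.symm_symm]
    exact Submodule.smithNormalFormBotBasis_def _ _ _
  let B : Matrix (Fin n) (Fin n) ℂ[X] := Matrix.of fun i j => b j i
  have hBD : ∀ i j, (B * diagonal (smithCoeff T ∘ σ)) i j = (c j : Fin n → ℂ[X]) i := by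
    intro i j
    rw [mul_diagonal, hbc]
    simp [B, mul_comm]
  constructor
  · have hcol : ∀ j, (fun i => charmatrix T i j) ∈ charRange T := fun j =>
      ⟨Pi.single j 1, by simp; rfl⟩
    refine ⟨B, Matrix.of fun l j => c.repr ⟨_, hcol j⟩ l, ?_⟩
    ext1 i j
    have h1 := congrArg Subtype.val (c.sum_repr ⟨_, hcol j⟩)
    simp only [Submodule.coe_sum, Submodule.coe_smul] at h1
    have h2 := congrFun h1 i
    rw [Matrix.mul_apply, ← h2, Finset.sum_apply]
    refine Finset.sum_congr rfl fun l _ => ?_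
    rw [hBD, Pi.smul_apply, smul_eq_mul, mul_comm]
    rfl
  · have hB : IsUnit B.det := by
      have h1 : B = (Pi.basisFun ℂ[X] (Fin n)).toMatrix b := by
        ext1 i j
        rfl
      rw [h1]
      have := Module.Basis.invertibleToMatrix (Pi.basisFun ℂ[X] (Fin n)) b
      exact Matrix.isUnit_det_of_invertible _
    choose w hw using fun j => (c j).2
    refine ⟨B⁻¹, Matrix.of fun l j => w j l, ?_⟩
    have h2 : charmatrix T * (Matrix.of fun l j => w j l) = B * diagonal (smithCoeff T ∘ σ) := by
      ext1 i j
      rw [hBD, ← hw]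
      rfl
    rw [Matrix.mul_assoc, h2, ← Matrix.mul_assoc, Matrix.nonsing_inv_mul _ hB, Matrix.one_mul]

section Multiplicities

variable {F G : Matrix (Fin n) (Fin n) ℂ}

theorem dvdMinors_charmatrix_iff (σ : Equiv.Perm (Fin n)) (d : ℂ[X]) (k : ℕ) :
    DvdMinors d k (charmatrix T) ↔ DvdMinors d k (diagonal (smithCoeff T ∘ σ)) := by
  obtain ⟨⟨P, Q, h⟩, P', Q', h'⟩ := exists_smith_factorization T σ
  constructor
  · intro hd
    rw [h']
    exact (hd.mul_left P').mul_right Q'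
  · intro hd
    rw [h]
    exact (hd.mul_left P).mul_right Q

theorem dvdMinors_pencilMatrix_iff (hG : G.det ≠ 0) (d : ℂ[X]) (k : ℕ) :
    DvdMinors d k (pencilMatrix F G) ↔ DvdMinors d k (charmatrix (-(G⁻¹ * F))) := by
  rw [pencilMatrix_eq_mul_charmatrix hG]
  constructor
  · intro h
    have h1 := h.mul_left ((G⁻¹).map C)
    have h2 : (G⁻¹).map C * G.map C = (1 : Matrix (Fin n) (Fin n) ℂ[X]) := by
      rw [← Matrix.map_mul, Matrix.nonsing_inv_mul _ hG.isUnit]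
      simp
    rwa [← Matrix.mul_assoc, h2, Matrix.one_mul] at h1
  · intro h
    exact h.mul_left _

theorem rootMultiplicity_prod {ι : Type*} (s : Finset ι) (a : ι → ℂ[X]) (ha : ∀ i, a i ≠ 0)
    (z : ℂ) : rootMultiplicity z (∏ i ∈ s, a i) = ∑ i ∈ s, rootMultiplicity z (a i) := by
  classical
  induction s using Finset.induction_on with
  | empty => simp [rootMultiplicity_eq_zero]
  | insert i s hi ih =>
    rw [Finset.prod_insert hi, Finset.sum_insert hi, rootMultiplicity_mul, ih]
    exact mul_ne_zero (ha i) (Finset.prod_ne_zero_iff.mpr fun j _ => ha j)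

theorem orderEmbedding_apply_le {k : ℕ} (f : Fin k ↪o Fin n) (i : Fin k) :
    (f i : ℕ) + k ≤ n + i := by
  suffices h : ∀ (d : ℕ) (i : Fin k), (i : ℕ) + d + 1 = k → (f i : ℕ) + d + 1 ≤ n by
    have := h (k - 1 - i) i (by omega)
    omega
  intro d
  induction d with
  | zero => intro i _; have := (f i).2; omega
  | succ d ih =>
    intro i hi
    have h1 := ih ⟨i + 1, by omega⟩ (by simp; omega)
    have h2 : f i < f ⟨i + 1, by omega⟩ := f.strictMono (by simp [Fin.lt_def])
    rw [Fin.lt_def] at h2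
    omega

/-- The exponents of a root in the Smith normal form, in decreasing order, determine the numbers
`l_i`. -/
theorem exists_exponents (hG : G.det ≠ 0) (z : ℂ) :
    ∃ e : ℕ → ℕ, Antitone e ∧ (∀ j, n ≤ j → e j = 0) ∧
      (∃ σ : Equiv.Perm (Fin n), ∀ j : Fin n,
        e j = rootMultiplicity z (smithCoeff (-(G⁻¹ * F)) (σ j))) ∧
      ∀ i ≤ n, minorMult F G z i = ∑ j ∈ Finset.Ico i n, e j := by
  set T := -(G⁻¹ * F) with hT
  let v : Fin n → ℕ := fun i => rootMultiplicity z (smithCoeff T i)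
  let σ : Equiv.Perm (Fin n) := Tuple.sort (OrderDual.toDual ∘ v)
  have hσ : Antitone (v ∘ σ) := fun i j hij => Tuple.monotone_sort (OrderDual.toDual ∘ v) hij
  let e : ℕ → ℕ := fun j => if h : j < n then v (σ ⟨j, h⟩) else 0
  have he : ∀ j : Fin n, e j = v (σ j) := fun j => dif_pos j.2
  have hanti : Antitone e := by
    intro i j hij
    by_cases hj : j < n
    · have hi : i < n := by omega
      simp only [e, dif_pos hj, dif_pos hi]
      exact hσ (Fin.mk_le_mk.mpr hij)
    · simp only [e, dif_neg hj, zero_le]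
  refine ⟨e, hanti, fun j hj => dif_neg (by omega), ⟨σ, he⟩, fun i hi => ?_⟩
  rw [minorMult]
  suffices h : (⨅ (f : Fin (n - i) ↪o Fin n) (g : Fin (n - i) ↪o Fin n),
      emultiplicity (X - C z) ((pencilMatrix F G).submatrix f g).det) =
      ((∑ j ∈ Finset.Ico i n, e j : ℕ) : ℕ∞) by rw [h, ENat.toNat_natCast]
  refine ENat.eq_of_forall_natCast_le_iff fun m => ?_
  have h1 : (m : ℕ∞) ≤ (⨅ (f : Fin (n - i) ↪o Fin n) (g : Fin (n - i) ↪o Fin n),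
      emultiplicity (X - C z) ((pencilMatrix F G).submatrix f g).det) ↔
      DvdMinors ((X - C z) ^ m) (n - i) (pencilMatrix F G) := by
    simp only [le_iInf_iff, ← pow_dvd_iff_le_emultiplicity]
    rfl
  rw [h1, dvdMinors_pencilMatrix_iff hG, dvdMinors_charmatrix_iff _ σ, dvdMinors_diagonal_iff,
    Nat.cast_le]
  have h2 : ∀ f : Fin (n - i) ↪o Fin n,
      (X - C z) ^ m ∣ ∏ j, (smithCoeff T ∘ σ) (f j) ↔ m ≤ ∑ j, e (f j) := by
    intro f
    simp only [Function.comp_apply]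
    rw [← le_rootMultiplicity_iff (Finset.prod_ne_zero_iff.mpr fun j _ => smithCoeff_ne_zero T _),
      rootMultiplicity_prod _ _ fun j => smithCoeff_ne_zero T _]
    simp only [he]
    rfl
  refine (forall_congr' h2).trans ?_
  have h3 : ∑ j ∈ Finset.Ico i n, e j = ∑ j : Fin (n - i), e (i + j) := by
    rw [Finset.sum_Ico_eq_sum_range, Finset.sum_range]
  rw [h3]
  constructor
  · intro h
    let f : Fin (n - i) ↪o Fin n := OrderEmbedding.ofStrictMono
      (fun j => ⟨i + j, by omega⟩) fun j l hjl => by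
        simp only [Fin.mk_lt_mk]
        exact Nat.add_lt_add_left hjl i
    exact h f
  · intro h f
    refine h.trans (Finset.sum_le_sum fun j _ => hanti ?_)
    have := orderEmbedding_apply_le f j
    omega

theorem filter_range_eq {p : ℕ → Bool} {d m : ℕ} (hd : d ≤ m) (hp : ∀ i, p i ↔ i < d) :
    (List.range m).filter p = List.range d := by
  obtain ⟨k, rfl⟩ := Nat.exists_eq_add_of_le hd
  rw [List.range_add, List.filter_append, List.filter_eq_self.mpr, List.filter_eq_nil_iff.mpr,
    List.append_nil]
  · intro x hx
    obtain ⟨y, -, rfl⟩ := List.mem_map.mp hx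
    rw [hp]
    omega
  · intro x hx
    exact (hp x).mpr (List.mem_range.mp hx)

theorem bracket_eq_map_range {z : ℂ} {e : ℕ → ℕ} (hanti : Antitone e)
    (hzero : ∀ j, n ≤ j → e j = 0)
    (he : ∀ i ≤ n, minorMult F G z i = ∑ j ∈ Finset.Ico i n, e j) :
    ∃ d ≤ n, (∀ i, 0 < e i ↔ i < d) ∧ bracket F G z = (List.range d).map e := by
  classical
  have hex : ∃ j, e j = 0 := ⟨n, hzero n le_rfl⟩
  have hd : ∀ i, 0 < e i ↔ i < Nat.find hex := by
    intro i
    constructor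
    · intro h
      by_contra hcon
      have := hanti (not_lt.mp hcon)
      rw [Nat.find_spec hex] at this
      omega
    · intro h
      exact Nat.pos_of_ne_zero (Nat.find_min hex h)
  have hdn : Nat.find hex ≤ n := Nat.find_min' hex (hzero n le_rfl)
  have hstep : ∀ i < n, minorMult F G z i = e i + minorMult F G z (i + 1) := by
    intro i hi
    rw [he i hi.le, he (i + 1) hi, Finset.sum_eq_sum_Ico_succ_bot hi]
  have hpos : ∀ i < n, 0 < minorMult F G z i ↔ 0 < e i := by
    intro i hi
    constructor
    · intro h
      by_contra hcon
      rw [he i hi.le] at h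
      obtain ⟨j, hj, hj'⟩ := Finset.exists_ne_zero_of_sum_ne_zero h.ne'
      have := hanti (Finset.mem_Ico.mp hj).1
      omega
    · intro h
      rw [hstep i hi]
      omega
  refine ⟨Nat.find hex, hdn, hd, ?_⟩
  have hfilter : (List.range n).filter (fun i => decide (0 < minorMult F G z i)) =
      List.range (Nat.find hex) := by
    rw [List.filter_congr (q := fun i => decide (0 < e i))]
    · exact filter_range_eq hdn fun i => by simpa using hd i
    · intro i hi
      simp only [hpos i (List.mem_range.mp hi)]
  rw [bracket, hfilter]
  refine List.map_congr_left fun i hi => ?_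
  rw [hstep i ((List.mem_range.mp hi).trans_le hdn)]
  omega

theorem natDegree_eq_sum_rootMultiplicity {p : ℂ[X]} {s : Finset ℂ}
    (hs : ∀ z, p.IsRoot z → z ∈ s) : p.natDegree = ∑ z ∈ s, rootMultiplicity z p := by
  rw [(IsAlgClosed.splits p).natDegree_eq_card_roots,
    ← Multiset.sum_count_eq_card (s := s) fun z hz => hs z (isRoot_of_mem_roots hz)]
  simp only [count_roots]

theorem rootMultiplicity_gcd {a b : ℂ[X]} (ha : a ≠ 0) (hb : b ≠ 0) (z : ℂ) :
    rootMultiplicity z (gcd a b) = min (rootMultiplicity z a) (rootMultiplicity z b) := by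
  have hg : gcd a b ≠ 0 := fun h => ha ((gcd_eq_zero_iff _ _).mp h).1
  refine eq_of_forall_le_iff fun m => ?_
  rw [le_min_iff, le_rootMultiplicity_iff hg, le_rootMultiplicity_iff ha,
    le_rootMultiplicity_iff hb, dvd_gcd_iff]

theorem smithCoeff_dvd_charpoly (i : Fin n) : smithCoeff T i ∣ T.charpoly := by
  obtain ⟨⟨P, Q, h⟩, -⟩ := exists_smith_factorization T 1
  rw [Matrix.charpoly, h, det_mul, det_mul, det_diagonal]
  exact ((Finset.dvd_prod_of_mem _ (Finset.mem_univ i)).mul_left _).mul_right _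

theorem charpoly_dvd_prod_smithCoeff : T.charpoly ∣ ∏ i, smithCoeff T i := by
  obtain ⟨-, P, Q, h⟩ := exists_smith_factorization T 1
  have h1 := congrArg det h
  rw [det_mul, det_mul, det_diagonal] at h1
  change ∏ i, smithCoeff T i = _ at h1
  rw [h1]
  exact (dvd_mul_left _ _).mul_right _

end Multiplicities

end Smith

section Count

theorem sum_min_eq {e : ℕ → ℕ} (he : Antitone e) (n : ℕ) :
    ∑ i ∈ Finset.range n, ∑ j ∈ Finset.range n, min (e i) (e j) =
      ∑ i ∈ Finset.range n, (2 * i + 1) * e i := by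
  induction n with
  | zero => simp
  | succ n ih =>
    have h1 : ∀ i ∈ Finset.range n, min (e i) (e n) = e n := fun i hi =>
      min_eq_right (he (Finset.mem_range.mp hi).le)
    have h2 : ∀ i ∈ Finset.range n, min (e n) (e i) = e n := fun i hi =>
      min_eq_left (he (Finset.mem_range.mp hi).le)
    rw [Finset.sum_range_succ, Finset.sum_range_succ (fun i => (2 * i + 1) * e i),
      Finset.sum_congr rfl fun i _ => Finset.sum_range_succ (fun j => min (e i) (e j)) n,
      Finset.sum_add_distrib, ih, Finset.sum_congr rfl h1, Finset.sum_range_succ,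
      Finset.sum_congr rfl h2, min_self, Finset.sum_const, Finset.card_range, smul_eq_mul]
    ring

variable {n : ℕ} {F G : Matrix (Fin n) (Fin n) ℂ}

/-- The exponents of the elementary divisors, in decreasing order for each root, determine the
Segre symbol and the dimension of the Lie algebra that annihilates the pencil. -/
theorem exists_exponents_of_pencil (hF : F.IsSymm) (hG : G.IsSymm) (hdet : G.det ≠ 0) :
    ∃ (e : ℂ → ℕ → ℕ) (d : ℂ → ℕ),
      (∀ z, Antitone (e z)) ∧ (∀ z i, 0 < e z i ↔ i < d z) ∧
      (∀ z, bracket F G z = (List.range (d z)).map (e z)) ∧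
      (∀ z ∈ (discriminant F G).roots.toFinset, 0 < d z) ∧
      (∑ z ∈ (discriminant F G).roots.toFinset, ∑ i ∈ Finset.range n, e z i = n) ∧
      Module.finrank ℂ (lieStabilizer F G) =
        ∑ z ∈ (discriminant F G).roots.toFinset, ∑ i ∈ Finset.range n, i * e z i := by
  choose e hanti hzero hσ hminor using exists_exponents (F := F) hdet
  choose d hdn hd hbracket using fun z => bracket_eq_map_range (hanti z) (hzero z) (hminor z)
  set T := -(G⁻¹ * F) with hT
  set Λ := (discriminant F G).roots.toFinset with hΛ
  have hmem : ∀ z, z ∈ Λ ↔ T.charpoly.IsRoot z := by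
    intro z
    rw [hΛ, Multiset.mem_toFinset, mem_roots (discriminant_ne_zero hdet),
      discriminant_eq_mul_charpoly hdet, IsRoot, IsRoot, eval_mul, eval_C, mul_eq_zero,
      or_iff_right hdet]
  have hroot : ∀ i z, (smithCoeff T i).IsRoot z → z ∈ Λ := fun i z h =>
    (hmem z).mpr (h.dvd (smithCoeff_dvd_charpoly T i))
  have hsum : ∑ z ∈ Λ, ∑ i ∈ Finset.range n, e z i = n := by
    refine Eq.trans ?_ (sum_natDegree_smithCoeff T)
    simp only [fun i => natDegree_eq_sum_rootMultiplicity (hroot i)]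
    rw [Finset.sum_comm (s := Finset.univ)]
    refine Finset.sum_congr rfl fun z _ => ?_
    obtain ⟨σ, hσ⟩ := hσ z
    rw [Finset.sum_range, ← Equiv.sum_comp σ fun i => rootMultiplicity z (smithCoeff T i)]
    exact Finset.sum_congr rfl fun i _ => hσ i
  have hcomm : Module.finrank ℂ (commutant T) =
      ∑ z ∈ Λ, ∑ i ∈ Finset.range n, (2 * i + 1) * e z i := by
    rw [finrank_commutant]
    have h1 : ∀ i j, (gcd (smithCoeff T i) (smithCoeff T j)).natDegree =
        ∑ z ∈ Λ, min (rootMultiplicity z (smithCoeff T i)) (rootMultiplicity z (smithCoeff T j)) := by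
      intro i j
      rw [natDegree_eq_sum_rootMultiplicity fun z h => hroot i z (h.dvd (gcd_dvd_left _ _))]
      exact Finset.sum_congr rfl fun z _ =>
        rootMultiplicity_gcd (smithCoeff_ne_zero T i) (smithCoeff_ne_zero T j) z
    simp only [h1]
    simp only [fun i => Finset.sum_comm (s := Finset.univ) (t := Λ) (f := fun j z =>
      min (rootMultiplicity z (smithCoeff T i)) (rootMultiplicity z (smithCoeff T j)))]
    rw [Finset.sum_comm]
    refine Finset.sum_congr rfl fun z _ => ?_
    obtain ⟨σ, hσ⟩ := hσ z
    rw [← sum_min_eq (hanti z), Finset.sum_range, ← Equiv.sum_comp σ]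
    refine Finset.sum_congr rfl fun i _ => ?_
    rw [Finset.sum_range, ← Equiv.sum_comp σ]
    refine Finset.sum_congr rfl fun j _ => ?_
    rw [hσ, hσ]
  refine ⟨e, d, hanti, hd, hbracket, fun z hz => ?_, hsum, ?_⟩
  · rw [← hd]
    have h1 : (∏ i, smithCoeff T i).IsRoot z :=
      ((hmem z).mp hz).dvd (charpoly_dvd_prod_smithCoeff T)
    rw [isRoot_prod] at h1
    obtain ⟨i, -, hi⟩ := h1
    have h2 := (rootMultiplicity_pos (smithCoeff_ne_zero T i)).mpr hi
    obtain ⟨σ, hσ⟩ := hσ z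
    have h3 := hσ (σ.symm i)
    rw [Equiv.apply_symm_apply] at h3
    have h4 := hanti z (Nat.zero_le (σ.symm i : ℕ))
    omega
  · have h1 := finrank_ker_pencilCommutator hF hG hdet
    rw [finrank_ker_pencilCommutator_eq hdet, hcomm] at h1
    have h2 : ∑ z ∈ Λ, ∑ i ∈ Finset.range n, (2 * i + 1) * e z i =
        2 * ∑ z ∈ Λ, ∑ i ∈ Finset.range n, i * e z i +
          ∑ z ∈ Λ, ∑ i ∈ Finset.range n, e z i := by
      rw [Finset.mul_sum, ← Finset.sum_add_distrib]
      refine Finset.sum_congr rfl fun z _ => ?_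
      rw [Finset.mul_sum, ← Finset.sum_add_distrib]
      exact Finset.sum_congr rfl fun i _ => by ring
    omega

end Count

section Segre

variable {Λ : Finset ℂ} {e : ℂ → ℕ → ℕ} {d : ℂ → ℕ}

/-- The contribution of a bracket to the dimension of the stabilizer. -/
def bracketWeight (b : List ℕ) : ℕ := b.getD 1 0 + 2 * b.getD 2 0

theorem bracketWeight_map_range {f : ℕ → ℕ} {m : ℕ} (hf : ∀ i, 0 < f i ↔ i < m) :
    bracketWeight ((List.range m).map f) = f 1 + 2 * f 2 := by
  have h : ∀ i, ((List.range m).map f).getD i 0 = f i := by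
    intro i
    by_cases hi : i < m
    · rw [List.getD_eq_getElem _ _ (by simpa using hi)]
      simp
    · rw [List.getD_eq_default _ _ (by simpa using hi)]
      have := (hf i).not.mpr hi
      omega
  rw [bracketWeight, h, h]

theorem numBrackets_map (g : ℂ → List ℕ) (i : ℕ) :
    numBrackets (Λ.val.map g) i = ∑ z ∈ Λ, if (g z).length = i then 1 else 0 := by
  rw [numBrackets, Multiset.countP_map, ← Finset.card_filter]
  rfl

theorem sum_index_mul_eq (hd : ∀ z i, 0 < e z i ↔ i < d z) (hlen : ∀ z ∈ Λ, d z < 4) {z : ℂ}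
    (hz : z ∈ Λ) : ∑ i ∈ Finset.range 6, i * e z i = e z 1 + 2 * e z 2 ∧
      ∑ i ∈ Finset.range 6, e z i = e z 0 + e z 1 + e z 2 := by
  have h3 : e z 3 = 0 := by have := hd z 3; have := hlen z hz; omega
  have h4 : e z 4 = 0 := by have := hd z 4; have := hlen z hz; omega
  have h5 : e z 5 = 0 := by have := hd z 5; have := hlen z hz; omega
  simp [Finset.sum_range_succ, h3, h4, h5]

/-- If some elementary divisor other than the largest one of its root has degree at least two, then
the Segre symbol is `[(22)11]`. -/
theorem segre_eq_of_two_le (hanti : ∀ z, Antitone (e z)) (hd : ∀ z i, 0 < e z i ↔ i < d z)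
    (hpos : ∀ z ∈ Λ, 0 < d z) (hcard : 3 ≤ Λ.card)
    (hsum : ∑ z ∈ Λ, (e z 0 + e z 1 + e z 2) = 6) {z₀ : ℂ} (hz₀ : z₀ ∈ Λ) (h2 : 2 ≤ e z₀ 1) :
    Λ.val.map (fun z => (List.range (d z)).map (e z)) = {[2, 2], [1], [1]} := by
  classical
  have h01 : ∀ z, e z 1 ≤ e z 0 := fun z => hanti z (by norm_num)
  have hone : ∀ z ∈ Λ, 1 ≤ e z 0 := fun z hz => (hd z 0).mpr (hpos z hz)
  have hcard' : 2 ≤ (Λ.erase z₀).card := by rw [Finset.card_erase_of_mem hz₀]; omega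
  have hsplit := Finset.add_sum_erase Λ (fun z => e z 0 + e z 1 + e z 2) hz₀
  simp only [hsum] at hsplit
  have hge : (Λ.erase z₀).card ≤ ∑ z ∈ Λ.erase z₀, (e z 0 + e z 1 + e z 2) := by
    rw [Finset.card_eq_sum_ones]
    refine Finset.sum_le_sum fun z hz => ?_
    have := hone z (Finset.mem_of_mem_erase hz)
    omega
  have := h01 z₀
  have hc : (Λ.erase z₀).card = 2 := by omega
  obtain ⟨z₁, z₂, hne, hpair⟩ := Finset.card_eq_two.mp hc
  have hz₁ : z₁ ∈ Λ := Finset.mem_of_mem_erase (by rw [hpair]; simp)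
  have hz₂ : z₂ ∈ Λ := Finset.mem_of_mem_erase (by rw [hpair]; simp)
  have hrest : ∑ z ∈ Λ.erase z₀, (e z 0 + e z 1 + e z 2) = 2 := by omega
  rw [hpair, Finset.sum_pair hne] at hrest
  have := hone z₁ hz₁
  have := hone z₂ hz₂
  have hlist1 : ∀ z ∈ Λ, e z 0 = 1 → e z 1 = 0 → (List.range (d z)).map (e z) = [1] := by
    intro z hz h0 h1
    have hd1 : d z = 1 := by have := hd z 1; have := hpos z hz; omega
    rw [hd1]
    simp [h0]
  have hlist2 : (List.range (d z₀)).map (e z₀) = [2, 2] := by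
    have hd2 : d z₀ = 2 := by have := hd z₀ 1; have := hd z₀ 2; omega
    have h0 : e z₀ 0 = 2 := by omega
    have h1 : e z₀ 1 = 2 := by omega
    rw [hd2]
    simp [List.range_succ, h0, h1]
  have hΛ : Λ = insert z₀ {z₁, z₂} := by rw [← hpair, Finset.insert_erase hz₀]
  have hz₀' : z₀ ∉ ({z₁, z₂} : Finset ℂ) := by rw [← hpair]; exact Finset.notMem_erase z₀ Λ
  rw [hΛ, Finset.insert_val_of_notMem hz₀', Finset.insert_val_of_notMem (by simpa using hne),
    Finset.singleton_val, Multiset.map_cons, Multiset.map_cons, Multiset.map_singleton, hlist2,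
    hlist1 z₁ hz₁ (by omega) (by omega), hlist1 z₂ hz₂ (by omega) (by omega)]
  rfl

/-- The sum of the contributions of the brackets in terms of their lengths. -/
theorem sum_weight_eq (hanti : ∀ z, Antitone (e z)) (hd : ∀ z i, 0 < e z i ↔ i < d z)
    (hlen : ∀ z ∈ Λ, d z < 4) (hle : ∀ z ∈ Λ, e z 1 ≤ 1) :
    ∑ z ∈ Λ, (e z 1 + 2 * e z 2) =
      numBrackets (Λ.val.map fun z => (List.range (d z)).map (e z)) 2 +
        3 * numBrackets (Λ.val.map fun z => (List.range (d z)).map (e z)) 3 := by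
  rw [numBrackets_map, numBrackets_map, Finset.mul_sum, ← Finset.sum_add_distrib]
  refine Finset.sum_congr rfl fun z hz => ?_
  simp only [List.length_map, List.length_range]
  have h1 := hle z hz
  have h2 : e z 2 ≤ e z 1 := hanti z (by norm_num)
  have h3 := hd z 1
  have h4 := hd z 2
  have h5 := hlen z hz
  split_ifs <;> omega

theorem segreSymbol_dim {G : Matrix (Fin 6) (Fin 6) ℂ} (hGsymm : G.IsSymm) (hG : G.det ≠ 0)
    {σ : Multiset (List ℕ)} (hlen : ∀ b ∈ σ, b.length < 4) (hcard : 3 ≤ σ.card)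
    {X : QuadraticComplex G} (hX : X.HasSegreSymbol σ) :
    (σ ≠ {[2, 2], [1], [1]} →
      dim X.stab = ((numBrackets σ 2 + 3 * numBrackets σ 3 : ℕ) : WithBot ℕ∞)) ∧
    (σ = {[2, 2], [1], [1]} → dim X.stab = 2) := by
  obtain ⟨F, hXF, hσ⟩ := hX
  have hFsymm : F.IsSymm := X.isSymm_of_mem F (by
    rw [hXF]; exact Submodule.subset_span (by simp))
  obtain ⟨e, d, hanti, hd, hbracket, hpos, hsum, hfin⟩ :=
    exists_exponents_of_pencil hFsymm hGsymm hG
  set Λ := (discriminant F G).roots.toFinset with hΛ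
  have hσ' : σ = Λ.val.map fun z => (List.range (d z)).map (e z) := by
    rw [← hσ, segreSymbol, hΛ, Multiset.toFinset_val]
    exact Multiset.map_congr rfl fun z _ => hbracket z
  have hcard' : 3 ≤ Λ.card := by rwa [hσ', Multiset.card_map] at hcard
  have hlen' : ∀ z ∈ Λ, d z < 4 := by
    intro z hz
    have := hlen _ (by rw [hσ']; exact Multiset.mem_map_of_mem _ hz)
    simpa using this
  obtain ⟨t₁, ht₁, t₂, ht₂, hne⟩ := Finset.one_lt_card.mp (show 1 < Λ.card by omega)
  have hdim : dim X.stab = ((∑ z ∈ Λ, (e z 1 + 2 * e z 2) : ℕ) : WithBot ℕ∞) := by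
    rw [dim_stab_eq_finrank hG hXF hne (isRoot_of_mem_roots (Multiset.mem_toFinset.mp ht₁))
      (isRoot_of_mem_roots (Multiset.mem_toFinset.mp ht₂)), hfin,
      Finset.sum_congr rfl fun z hz => (sum_index_mul_eq hd hlen' hz).1]
  rw [Finset.sum_congr rfl fun z hz => (sum_index_mul_eq hd hlen' hz).2] at hsum
  rw [hdim]
  constructor
  · intro hexc
    rw [sum_weight_eq hanti hd hlen' fun z hz => ?_, hσ']
    by_contra! hcon
    exact hexc (hσ'.trans (segre_eq_of_two_le hanti hd hpos hcard' hsum hz hcon))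
  · intro hexc
    have h1 : ∑ z ∈ Λ, (e z 1 + 2 * e z 2) = (σ.map bracketWeight).sum := by
      rw [hσ', Multiset.map_map]
      refine Finset.sum_congr rfl fun z _ => ?_
      exact (bracketWeight_map_range (hd z)).symm
    rw [h1, hexc]
    rfl

end Segre

end QuadraticLineComplex

end

theorem lemma4p5 (G : Matrix (Fin 6) (Fin 6) ℂ) (hGsymm : G.IsSymm) (hGsmooth : G.det ≠ 0)
    (σ : Multiset (List ℕ)) (hlen : ∀ b ∈ σ, b.length < 4) (hcard : 3 ≤ σ.card) :
    (σ ≠ {[2, 2], [1], [1]} →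
      ∀ X : QuadraticLineComplex.QuadraticComplex G, X.HasSegreSymbol σ →
        QuadraticLineComplex.dim X.stab =
          ((QuadraticLineComplex.numBrackets σ 2 + 3 * QuadraticLineComplex.numBrackets σ 3 : ℕ) :
            WithBot ℕ∞)) ∧
    (σ = {[2, 2], [1], [1]} →
      ∀ X : QuadraticLineComplex.QuadraticComplex G, X.HasSegreSymbol σ →
        QuadraticLineComplex.dim X.stab = 2) ∧
    (∀ X Y : QuadraticLineComplex.QuadraticComplex G, X.HasSegreSymbol σ → Y.HasSegreSymbol σ →
      QuadraticLineComplex.dim X.stab = QuadraticLineComplex.dim Y.stab) := by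
  have h := fun (X : QuadraticLineComplex.QuadraticComplex G) (hX : X.HasSegreSymbol σ) =>
    QuadraticLineComplex.segreSymbol_dim hGsymm hGsmooth hlen hcard hX
  refine ⟨fun hσ X hX => (h X hX).1 hσ, fun hσ X hX => (h X hX).2 hσ, fun X Y hX hY => ?_⟩
  by_cases hσ : σ = {[2, 2], [1], [1]}
  · rw [(h X hX).2 hσ, (h Y hY).2 hσ]
  · rw [(h X hX).1 hσ, (h Y hY).1 hσ]
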